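/- **Definitions.** A *probabilistic $k$-OBDD of width $w$* over $x_1,\dots,x_n$ is a leveled oblivious probabilistic branching program with at most $w$ nodes on every level, consisting of $k$ consecutive layers, each of which reads every variable exactly once, all in one common order $\theta$; at each node, for each value of the variable read there, the next node is chosen at random according to a fixed distribution. It computes $f:\{0,1\}^n\to\{0,1\}$ with bounded error $\delta>0$ if, for every input $x$, it reaches a $1$-sink with probability $>\frac12+\delta$ when $f(x)=1$ and with probability $<\frac12-\delta$ when $f(x)=0$. For $k:\mathbb N\to\mathbb N$ and a set $C$ of functions $w:\mathbb N\to\mathbb N$, let $k\text{-}\mathbf{POBDD}_C$ be the set of families $(f_n)_{n}$, $f_n:\{0,1\}^n\to\{0,1\}$, for which there are $w\in C$ and $\delta>0$ (independent of $n$) such that for every $n$ the function $f_n$ is computed with bounded error $\delta$ by a probabilistic $k(n)$-OBDD of width $w(n)$. Put $$\mathtt{const}=\{w: w \text{ constant},\ w>20\},\quad \mathtt{superpolylog}=\{w: w=O(\log^z n)\text{ for some constant } z\},\quad \mathtt{sublinear}_\alpha=\{w: w=O(n^\alpha)\}.$$ The *shuffled address function* $SAF_{k,w}:\{0,1\}^n\to\{0,1\}$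 is defined when $2kw(2w+\lceil\log_2 k\rceil+\lceil\log_2 2w\rceil)<n$ (for other $n$ put $SAF_{k,w}=0$). Split the first $2kwa$ variables into $2kw$ consecutive blocks, numbered from $0$, of $a=\lfloor n/(2kw)\rfloor$ variables. In each block the first $\lceil\log_2 k\rceil$ variables, read as a binary number (least significant bit first) modulo $k$, and the next $\lceil\log_2 2w\rceil$ variables, read as a binary number (least significant bit first) modulo $2w$, form the address $(t,i)$ of the block; the value of the block is the number of ones among its remaining variables, modulo $w$. Let $Val(i,t)\in\{0,\dots,w-1\}$ be the value of the lowest-numbered block with address $(t,i)$. Put $s_{-1}=0$ and, for $t=0,\dots,k-1$, $u_t=Val(s_{t-1},t)+w$ and $s_t=Val(u_t,t)$. Then $SAF_{k,w}(X)=1$ if all the blocks needed exist and $s_{k-1}>0$, and $SAF_{k,w}(X)=0$ otherwise. **Theorem.** Let $C$ be one of $\mathtt{const}$, $\mathtt{superpolylog}$, $\mathtt{sublinear}_\alpha$ with $0<\alpha<\frac12$. Let $k=k(n)$ and $w=w(n)$ be integer functions and $r=r(n)$ a positive real function with $k>4$, $w>20$, $w\in C$, $$k w^2\log_2\bigl(k(\log_2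 w+\log_2 k)\bigr)=o(n),$$ and $$v^2\log_2\bigl(k(\log_2 k+\log_2 v)\bigr)=o(r)\quad\text{for every } v\in C \text{ with } v>20 .$$ Then $$\lfloor k/r\rfloor\text{-}\mathbf{POBDD}_C\subsetneq k\text{-}\mathbf{POBDD}_C ,$$ and the family $SAF_{\lfloor k/2\rfloor,\lfloor (w-1)/3\rfloor}$ belongs to $k\text{-}\mathbf{POBDD}_C$ but not to $\lfloor k/r\rfloor\text{-}\mathbf{POBDD}_C$. -/

import Mathlib

open Filter Asymptotics

noncomputable section

/-- A family of Boolean functions, one function of `n` variables for every `n`. -/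
abbrev BoolFamily : Type := (n : ℕ) → (Fin n → Bool) → Bool

/-! ### Probabilistic ordered read-`k`-times branching programs -/

/-- A probabilistic `k`-OBDD of width `w` over `n` Boolean variables: a leveled oblivious program
made of `k` consecutive layers, each of which reads all the variables once, in one and the same
order. Every level has the `w` nodes `Fin w` (a smaller level is padded with unreachable nodes).
In layer `i`, at position `j`, the variable `order j` is read, and if its value is `b` then the
computation goes from node `u` to node `u'` of the next level with probability
`trans i j b u u'`. Computation starts in the node `source`; the nodes of the last level are the
sinks, and those in `accept` are the `1`-sinks. -/
structure POBDD (k n w : ℕ) where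
  order : Equiv.Perm (Fin n)
  source : Fin w
  accept : Finset (Fin w)
  trans : Fin k → Fin n → Bool → Matrix (Fin w) (Fin w) ℝ
  trans_stochastic : ∀ i j b, trans i j b ∈ Matrix.rowStochastic ℝ (Fin w)

namespace POBDD

variable {k n w : ℕ}

/-- The transition matrix of layer `i` on the input `x`. -/
def layerMatrix (P : POBDD k n w) (i : Fin k) (x : Fin n → Bool) : Matrix (Fin w) (Fin w) ℝ :=
  (List.ofFn fun j : Fin n => P.trans i j (x (P.order j))).prod

/-- The transition matrix of the whole program on the input `x`. -/
def totalMatrix (P : POBDD k n w) (x : Fin n → Bool) : Matrix (Fin w) (Fin w) ℝ :=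
  (List.ofFn fun i : Fin k => P.layerMatrix i x).prod

/-- The probability that the program reaches a `1`-sink on the input `x`. -/
def acceptProb (P : POBDD k n w) (x : Fin n → Bool) : ℝ :=
  ∑ t ∈ P.accept, P.totalMatrix x P.source t

/-- The program computes `f` with bounded error `δ`. -/
def Computes (P : POBDD k n w) (δ : ℝ) (f : (Fin n → Bool) → Bool) : Prop :=
  ∀ x, (f x = true → 1 / 2 + δ < P.acceptProb x) ∧ (f x = false → P.acceptProb x < 1 / 2 - δ)

end POBDD

/-- The class `k`-POBDD`_C`: the families computed, for some width `w ∈ C` and some constant error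
margin `δ > 0` (the same for all `n`), by `k n`-POBDDs of width `w n`. -/
def POBDDClass (k : ℕ → ℕ) (C : Set (ℕ → ℕ)) : Set BoolFamily :=
  {f | ∃ w ∈ C, ∃ δ : ℝ, 0 < δ ∧ ∀ n, ∃ P : POBDD (k n) n (w n), P.Computes δ (f n)}

/-! ### The classes of width functions -/

/-- Constant widths greater than `20`. -/
def constWidth : Set (ℕ → ℕ) := {w | ∃ c : ℕ, 20 < c ∧ ∀ n, w n = c}

/-- Widths `O((log n) ^ z)` for some constant `z`. -/
def superpolylogWidth : Set (ℕ → ℕ) :=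
  {w | ∃ z : ℕ, (fun n => (w n : ℝ)) =O[atTop] fun n : ℕ => Real.logb 2 (n : ℝ) ^ z}

/-- Widths `O(n ^ α)`. -/
def sublinearWidth (α : ℝ) : Set (ℕ → ℕ) :=
  {w | (fun n => (w n : ℝ)) =O[atTop] fun n : ℕ => (n : ℝ) ^ α}

/-! ### The shuffled address function -/

namespace SAF

/-- The `m`-th input bit as a number (variables are numbered from `0`). -/
def bit {n : ℕ} (x : Fin n → Bool) (m : ℕ) : ℕ := if h : m < n then (x ⟨m, h⟩).toNat else 0

/-- The number of variables in each of the `2kw` blocks. The remaining variables, fewer than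
`2kw` of them, are not used. -/
def blockLen (n k w : ℕ) : ℕ := n / (2 * k * w)

/-- The number of address variables of a block, `⌈log k⌉ + ⌈log 2w⌉`. -/
def addrLen (k w : ℕ) : ℕ := Nat.clog 2 k + Nat.clog 2 (2 * w)

/-- The number of value variables of a block. -/
def valLen (n k w : ℕ) : ℕ := blockLen n k w - addrLen k w

variable {n : ℕ} (k w : ℕ) (x : Fin n → Bool)

/-- The `j`-th address variable of block `p`. -/
def addrVar (p j : ℕ) : ℕ := bit x (p * blockLen n k w + j)

/-- The `j`-th value variable of block `p`. -/
def valVar (p j : ℕ) : ℕ := bit x (p * blockLen n k w + addrLen k w + j)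

/-- The first part of the address of block `p`: the step in which the block is used. -/
def adrK (p : ℕ) : ℕ := (∑ j ∈ Finset.range (Nat.clog 2 k), addrVar k w x p j * 2 ^ j) % k

/-- The second part of the address of block `p`: its address within that step. -/
def adrW (p : ℕ) : ℕ :=
  (∑ j ∈ Finset.range (Nat.clog 2 (2 * w)), addrVar k w x p (j + Nat.clog 2 k) * 2 ^ j) % (2 * w)

/-- The least number of a block with address `(t, i)`; `none` (written `-1` on paper) if there is
no such block. -/
def ind (i t : ℕ) : Option ℕ :=
  (List.range (2 * k * w)).find? fun p => decide (adrK k w x p = t ∧ adrW k w x p = i)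

/-- The value, modulo `w`, of the block with address `(t, i)`, if there is one. -/
def val (i t : ℕ) : Option ℕ :=
  (ind k w x i t).map fun p => (∑ j ∈ Finset.range (valLen n k w), valVar k w x p j) % w

/-- The first half of step `t`, from the outcome `s` of the preceding step. -/
def step₁ (s : Option ℕ) (t : ℕ) : Option ℕ := s.bind fun i => (val k w x i t).map (· + w)

/-- The outcome of the first `t` steps (steps `0, …, t - 1`), starting from the address `0`. -/
def step₂ : ℕ → Option ℕ
  | 0 => some 0
  | t + 1 => (step₁ k w x (step₂ t) t).bind fun i => val k w x i t

end SAF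

/-- The shuffled address function `SAF_{k,w}` of `n` variables. It is meant for
`2kw(2w + ⌈log k⌉ + ⌈log 2w⌉) < n`, and it is put to `0` for the other `n`.
The value is `1` exactly when the last step has an outcome and this outcome is positive. -/
def safFun (k w n : ℕ) (x : Fin n → Bool) : Bool :=
  decide (2 * k * w * (2 * w + Nat.clog 2 k + Nat.clog 2 (2 * w)) < n ∧
    0 < (SAF.step₂ k w x k).getD 0)

end

/-! ### Deterministic machines as branching programs -/

/-! Upper bound. `SAF` is a chain of two lookups per step, and one pass over the input performs one
lookup. The pass need not store the address that it reads: the address is so short that at most two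
numbers have the wanted residue, so two flags for bitwise comparison suffice
(`SAF.iter_blockStep_some`). With a "found" flag and the register this makes 8(2w+1) states
(`exists_POBDD_safFun`). For the parameters ⌊k/2⌋ and ⌊(w-1)/3⌋, at most k layers and width 8w are
needed, and C is closed under constant factors.

Lower bound. Cut every layer of a K-layer program of width v at one position of the order. The
matrix of layer i becomes a product of A_i, which depends only on the variables before the cut, and
B_i, which depends only on the others. If two assignments of the first part have all K v² entries of
the A_i in the same cells of a fine grid, then their acceptance probabilities differ by at most 2δ
under every continuation, so they cannot be separated. Hence only about (Kv/δ)^(Kv²) assignments can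
be distinguished (`POBDD.card_le_of_separated`).

For every order, `SAF` contains an index problem (`SAF.exists_separated_inputs`): bits c are read
before the cut, bits b after it, and b selects the bit of c that is the output. So 2^(k-1)
assignments must be distinguished, k being the first parameter of `SAF`. For K = ⌊k/r⌋ the growth
condition on r rules this out (`two_pow_gt`).

Inclusion. Eventually r ≥ 1, so idle layers can be added; the finitely many other n are computed by
brute force within a constant width. -/

/-- Apply `g 0`, …, `g (m - 1)` one after the other. -/
def iter {T : Type*} (g : ℕ → T → T) : ℕ → T → T
  | 0, s => s
  | m + 1, s => g m (iter g m s)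

lemma iter_congr {T : Type*} {g g' : ℕ → T → T} {m : ℕ} (h : ∀ i < m, g i = g' i) (s : T) :
    iter g m s = iter g' m s := by
  induction m with
  | zero => rfl
  | succ m ih => simp only [iter]; rw [ih fun i hi => h i (by omega), h m (by omega)]

lemma iter_mem {T : Type*} {g : ℕ → T → T} {G : Set T} (h : ∀ i, ∀ s ∈ G, g i s ∈ G) (m : ℕ)
    {s : T} (hs : s ∈ G) : iter g m s ∈ G := by
  induction m with
  | zero => exact hs
  | succ m ih => exact h m _ ih

/-- Carries a run over to the numbered nodes. The relation is asked for only on an invariant set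
`G`, since the numbering of states is injective only there. -/
lemma iter_semiconj {T U : Type*} {g : ℕ → T → T} {g' : ℕ → U → U} {G : Set T} {e : T → U}
    (h : ∀ i, ∀ s ∈ G, g i s ∈ G) (he : ∀ i, ∀ s ∈ G, g' i (e s) = e (g i s)) (m : ℕ)
    {s : T} (hs : s ∈ G) : iter g' m (e s) = e (iter g m s) := by
  induction m with
  | zero => rfl
  | succ m ih => simp only [iter]; rw [ih, he _ _ (iter_mem h m hs)]

/-- The transition matrix of a deterministic step. -/
def funMatrix {α : Type*} [DecidableEq α] (f : α → α) : Matrix α α ℝ :=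
  fun u u' => if f u = u' then 1 else 0

section
variable {α : Type*} [Fintype α] [DecidableEq α]

lemma funMatrix_mem_rowStochastic (f : α → α) : funMatrix f ∈ Matrix.rowStochastic ℝ α := by
  rw [Matrix.mem_rowStochastic_iff_sum]
  refine ⟨fun i j => ?_, fun i => ?_⟩
  · unfold funMatrix; split_ifs <;> norm_num
  · simp [funMatrix]

lemma funMatrix_mul (f g : α → α) : funMatrix f * funMatrix g = funMatrix (g ∘ f) := by
  ext u u'
  simp only [Matrix.mul_apply, funMatrix, ite_mul, one_mul, zero_mul, Finset.sum_ite_eq,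
    Finset.mem_univ, if_true, Function.comp_apply]

lemma prod_ofFn_funMatrix (g : ℕ → α → α) (n : ℕ) :
    (List.ofFn fun j : Fin n => funMatrix (g j)).prod = funMatrix (iter g n) := by
  induction n with
  | zero =>
    ext u u'
    by_cases h : u = u' <;> simp [funMatrix, iter, h]
  | succ n ih =>
    rw [List.ofFn_succ']
    simp only [List.concat_eq_append, List.prod_append, Fin.val_castSucc, Fin.val_last,
      List.prod_singleton]
    rw [ih, funMatrix_mul]
    rfl

end

lemma SAF.bit_fin {n : ℕ} (x : Fin n → Bool) (j : Fin n) : SAF.bit x j = (x j).toNat := by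
  simp [SAF.bit]

/-- A deterministic machine that reads the input once per layer and stays in a set of at most `W`
states is a program of width `W`. -/
theorem exists_POBDD_of_machine {T : Type} {k n W : ℕ} (G : Finset T) (hG : G.card ≤ W)
    (step : ℕ → ℕ → ℕ → T → T) (hstep : ∀ i j b, ∀ s ∈ G, step i j b s ∈ G)
    {s₀ : T} (hs₀ : s₀ ∈ G) (acc : T → Bool) {f : (Fin n → Bool) → Bool}
    (hf : ∀ x, acc (iter (fun i => iter (fun j => step i j (SAF.bit x j)) n) k s₀) = f x)
    {δ : ℝ} (hδ : δ < 1 / 2) : ∃ P : POBDD k n W, P.Computes δ f := by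
  classical
  -- The value outside `G` is a dummy: runs never leave `G`.
  let e : T → Fin W := fun s => if h : s ∈ G then Fin.castLE hG (G.equivFin ⟨s, h⟩) else
    Fin.castLE hG (G.equivFin ⟨s₀, hs₀⟩)
  have einj : Set.InjOn e (G : Set T) := by
    intro s hs t ht h
    have hs' : s ∈ G := hs
    have ht' : t ∈ G := ht
    simp only [e, hs', ht', dif_pos] at h
    have := G.equivFin.injective (Fin.castLE_injective hG h)
    exact congrArg Subtype.val this
  have : Nonempty T := ⟨s₀⟩
  let d : Fin W → T := Function.invFunOn e (G : Set T)
  have hd : ∀ s ∈ G, d (e s) = s := fun s hs => einj.leftInvOn_invFunOn hs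
  let F : ℕ → ℕ → ℕ → Fin W → Fin W := fun i j b u => e (step i j b (d u))
  let P : POBDD k n W :=
    { order := Equiv.refl _
      source := e s₀
      accept := Finset.univ.filter fun u => acc (d u) = true
      trans := fun i j b => funMatrix (F i j b.toNat)
      trans_stochastic := fun i j b => funMatrix_mem_rowStochastic _ }
  refine ⟨P, fun x => ?_⟩
  have hl : ∀ i : Fin k, P.layerMatrix i x =
      funMatrix ((fun i => iter (fun j => F i j (SAF.bit x j)) n) (i : ℕ)) := by
    intro i
    rw [← prod_ofFn_funMatrix]
    simp [POBDD.layerMatrix, P, SAF.bit_fin]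
  have ht : P.totalMatrix x =
      funMatrix (iter (fun i => iter (fun j => F i j (SAF.bit x j)) n) k) := by
    rw [← prod_ofFn_funMatrix]
    simp only [POBDD.totalMatrix, hl]
  have hG' : ∀ i, ∀ s ∈ (G : Set T), iter (fun j => step i j (SAF.bit x j)) n s ∈ (G : Set T) :=
    fun i s hs => iter_mem (fun j s hs => hstep _ _ _ s hs) n hs
  have hfin : iter (fun i => iter (fun j => F i j (SAF.bit x j)) n) k (e s₀) =
      e (iter (fun i => iter (fun j => step i j (SAF.bit x j)) n) k s₀) := by
    refine iter_semiconj (G := (G : Set T)) hG' (fun i s hs => ?_) k hs₀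
    refine iter_semiconj (G := (G : Set T)) (fun j s hs => hstep _ _ _ s hs)
      (fun j s hs => ?_) n hs
    simp only [F]
    rw [hd s hs]
  have hacc : P.acceptProb x = if f x = true then 1 else 0 := by
    have hmem := iter_mem hG' k (s := s₀) hs₀
    simp only [POBDD.acceptProb, ht, funMatrix]
    simp only [P, hfin, Finset.sum_ite_eq, Finset.mem_filter, Finset.mem_univ, true_and]
    rw [hd _ hmem, hf]
  rw [hacc]
  constructor
  · intro h; rw [if_pos h]; linarith
  · intro h; simp only [h, Bool.false_eq_true, if_false]; linarith

/-- With `2 ^ n` nodes per level and one layer, everything can be computed. -/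
theorem exists_POBDD_of_two_pow_le {k n W : ℕ} (hk : 0 < k) (hW : 2 ^ n ≤ W)
    (f : (Fin n → Bool) → Bool) {δ : ℝ} (hδ : δ < 1 / 2) : ∃ P : POBDD k n W, P.Computes δ f := by
  refine exists_POBDD_of_machine (T := Fin n → Bool) Finset.univ (by simpa using hW)
    (fun _ j b s => fun m => if (m : ℕ) = j then decide (b = 1) else s m)
    (fun _ _ _ _ _ => Finset.mem_univ _) (s₀ := fun _ => false) (Finset.mem_univ _) f
    (fun x => ?_) hδ
  congr 1
  have key : ∀ (m : ℕ) (s : Fin n → Bool) (j : Fin n), (j : ℕ) < m →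
      iter (fun (j : ℕ) (s : Fin n → Bool) (m : Fin n) =>
        if (m : ℕ) = j then decide (SAF.bit x j = 1) else s m) m s j = x j := by
    intro m s j hj
    induction m with
    | zero => omega
    | succ m ih =>
      simp only [iter]
      split_ifs with h
      · rw [← h, SAF.bit_fin]; cases x j <;> simp
      · exact ih (by omega)
  -- There is a last layer, and it rewrites every stored bit, whatever was stored before.
  obtain ⟨k, rfl⟩ := Nat.exists_eq_succ_of_ne_zero hk.ne'
  funext j
  exact key n _ j j.2

/-! ### Padding -/

namespace POBDD

lemma computes_mono {k n w : ℕ} {P : POBDD k n w} {δ δ' : ℝ} (h : δ' ≤ δ)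
    {f : (Fin n → Bool) → Bool} (hP : P.Computes δ f) : P.Computes δ' f :=
  fun x => ⟨fun hx => by linarith [(hP x).1 hx], fun hx => by linarith [(hP x).2 hx]⟩

/-- Layers that do nothing can be added. -/
theorem exists_computes_of_layers_le {K k n w : ℕ} (h : K ≤ k) (P : POBDD K n w) {δ : ℝ}
    {f : (Fin n → Bool) → Bool} (hP : P.Computes δ f) : ∃ Q : POBDD k n w, Q.Computes δ f := by
  obtain ⟨d, rfl⟩ := Nat.exists_eq_add_of_le h
  let Q : POBDD (K + d) n w :=
    { order := P.order
      source := P.source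
      accept := P.accept
      trans := fun i j b => Fin.append (fun i => P.trans i j b) (fun _ => 1) i
      trans_stochastic := fun i j b => by
        refine Fin.addCases (fun i => ?_) (fun i => ?_) i
        · rw [Fin.append_left]; exact P.trans_stochastic _ _ _
        · rw [Fin.append_right]; exact one_mem _ }
  have hQ : ∀ x, Q.totalMatrix x = P.totalMatrix x := by
    intro x
    have h1 : (fun i => Q.layerMatrix i x) =
        Fin.append (fun i => P.layerMatrix i x) (fun _ => 1) := by
      funext i
      refine Fin.addCases (fun i => ?_) (fun i => ?_) i
      · rw [Fin.append_left]
        simp only [layerMatrix, Q, Fin.append_left]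
      · rw [Fin.append_right]
        simp only [layerMatrix, Q, Fin.append_right]
        simp
    simp only [totalMatrix]
    rw [h1, List.ofFn_fin_append]
    simp
  refine ⟨Q, fun x => ?_⟩
  have : Q.acceptProb x = P.acceptProb x := by simp only [acceptProb, hQ]; rfl
  rw [this]; exact hP x

end POBDD

/-- A matrix on `Fin w`, completed by the identity on the remaining indices of `Fin W`. -/
def padMatrix {w : ℕ} (W : ℕ) (M : Matrix (Fin w) (Fin w) ℝ) : Matrix (Fin W) (Fin W) ℝ :=
  fun u u' => if h : (u : ℕ) < w then (if h' : (u' : ℕ) < w then M ⟨u, h⟩ ⟨u', h'⟩ else 0)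
    else if u = u' then 1 else 0

lemma sum_fin_dite_lt {w W : ℕ} (h : w ≤ W) (g : Fin w → ℝ) :
    ∑ u : Fin W, (if h' : (u : ℕ) < w then g ⟨u, h'⟩ else 0) = ∑ u : Fin w, g u := by
  obtain ⟨d, rfl⟩ := Nat.exists_eq_add_of_le h
  rw [Fin.sum_univ_add]
  simp

lemma padMatrix_mem_rowStochastic {w W : ℕ} (h : w ≤ W) {M : Matrix (Fin w) (Fin w) ℝ}
    (hM : M ∈ Matrix.rowStochastic ℝ (Fin w)) : padMatrix W M ∈ Matrix.rowStochastic ℝ (Fin W) := by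
  rw [Matrix.mem_rowStochastic_iff_sum] at hM ⊢
  refine ⟨fun i j => ?_, fun i => ?_⟩
  · unfold padMatrix; split_ifs <;> first | exact hM.1 _ _ | norm_num
  · unfold padMatrix
    by_cases hi : (i : ℕ) < w
    · simp only [hi, dif_pos]
      rw [sum_fin_dite_lt h fun u => M ⟨i, hi⟩ u]
      exact hM.2 _
    · simp [hi]

lemma padMatrix_one {w : ℕ} (W : ℕ) : padMatrix W (1 : Matrix (Fin w) (Fin w) ℝ) = 1 := by
  ext u u'
  simp only [padMatrix, Matrix.one_apply, Fin.ext_iff]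
  split_ifs <;> first | rfl | omega

lemma padMatrix_mul {w W : ℕ} (h : w ≤ W) (M N : Matrix (Fin w) (Fin w) ℝ) :
    padMatrix W (M * N) = padMatrix W M * padMatrix W N := by
  ext u u'
  rw [Matrix.mul_apply]
  by_cases hu : (u : ℕ) < w
  · have : ∀ a : Fin W, padMatrix W M u a * padMatrix W N a u' =
        if h' : (a : ℕ) < w then (fun a : Fin w => M ⟨u, hu⟩ a *
          (if h' : (u' : ℕ) < w then N a ⟨u', h'⟩ else 0)) ⟨a, h'⟩ else 0 := by
      intro a
      by_cases ha : (a : ℕ) < w <;> simp [padMatrix, hu, ha]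
    refine Eq.trans ?_ ((Finset.sum_congr rfl fun a _ => this a).trans
      (sum_fin_dite_lt h fun a : Fin w => M ⟨u, hu⟩ a *
          (if h' : (u' : ℕ) < w then N a ⟨u', h'⟩ else 0))).symm
    by_cases hu' : (u' : ℕ) < w <;> simp [padMatrix, hu, hu', Matrix.mul_apply]
  · have : ∀ a : Fin W, padMatrix W M u a * padMatrix W N a u' =
        if u = a then padMatrix W N a u' else 0 := by
      intro a
      by_cases ha : u = a
      · subst ha; simp [padMatrix, hu]
      · simp [padMatrix, hu, ha]
    rw [Finset.sum_congr rfl fun a _ => this a]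
    simp [padMatrix, hu]

lemma padMatrix_prod_ofFn {w W m : ℕ} (h : w ≤ W) (g : Fin m → Matrix (Fin w) (Fin w) ℝ) :
    (List.ofFn fun j => padMatrix W (g j)).prod = padMatrix W (List.ofFn g).prod := by
  induction m with
  | zero => simp [padMatrix_one]
  | succ m ih =>
    rw [List.ofFn_succ, List.prod_cons, ih fun j => g j.succ, List.ofFn_succ, List.prod_cons,
      padMatrix_mul h]

/-- Unreachable nodes can be added. -/
theorem POBDD.exists_computes_of_width_le {k n w W : ℕ} (h : w ≤ W) (P : POBDD k n w) {δ : ℝ}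
    {f : (Fin n → Bool) → Bool} (hP : P.Computes δ f) : ∃ Q : POBDD k n W, Q.Computes δ f := by
  let Q : POBDD k n W :=
    { order := P.order
      source := Fin.castLE h P.source
      accept := P.accept.map (Fin.castLEEmb h)
      trans := fun i j b => padMatrix W (P.trans i j b)
      trans_stochastic := fun i j b => padMatrix_mem_rowStochastic h (P.trans_stochastic i j b) }
  refine ⟨Q, fun x => ?_⟩
  have hl : ∀ i, Q.layerMatrix i x = padMatrix W (P.layerMatrix i x) :=
    fun i => padMatrix_prod_ofFn h _
  have ht : Q.totalMatrix x = padMatrix W (P.totalMatrix x) := by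
    simp only [totalMatrix, hl]
    exact padMatrix_prod_ofFn h _
  have : Q.acceptProb x = P.acceptProb x := by
    simp only [acceptProb, ht]
    simp [Q, padMatrix]
  rw [this]; exact hP x

/-! ### Splitting iterations into phases. -/

lemma iter_add {T : Type*} (g : ℕ → T → T) (m d : ℕ) (s : T) :
    iter g (m + d) s = iter (fun i => g (m + i)) d (iter g m s) := by
  induction d with
  | zero => rfl
  | succ d ih =>
    change g (m + d) (iter g (m + d) s) = _
    rw [ih]; rfl

lemma iter_id {T : Type*} {g : ℕ → T → T} (h : ∀ i s, g i s = s) (m : ℕ) (s : T) :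
    iter g m s = s := by
  induction m with
  | zero => rfl
  | succ m ih => simp only [iter]; rw [ih, h]

/-- A machine acts only when it reads a variable, so the initialisation of a phase is merged with
the reading of its first variable. -/
lemma iter_pre {T : Type*} (act : ℕ → T → T) (pre : T → T) {L : ℕ} (hL : 0 < L) (s : T) :
    iter (fun j s => act j (if j = 0 then pre s else s)) L s = iter act L (pre s) := by
  induction L with
  | zero => omega
  | succ L ih =>
    rcases Nat.eq_zero_or_pos L with rfl | h
    · rfl
    · simp only [iter]; rw [ih h, if_neg h.ne']

/-! ### Binary numbers -/

lemma sum_bits_lt {β : ℕ → ℕ} (hβ : ∀ j, β j ≤ 1) (L : ℕ) :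
    ∑ j ∈ Finset.range L, β j * 2 ^ j < 2 ^ L := by
  induction L with
  | zero => simp
  | succ L ih =>
    rw [Finset.sum_range_succ, pow_succ]
    have := Nat.mul_le_mul_right (2 ^ L) (hβ L)
    omega

lemma sum_bits_inj {β β' : ℕ → ℕ} (hβ : ∀ j, β j ≤ 1) (hβ' : ∀ j, β' j ≤ 1) {L : ℕ}
    (h : ∑ j ∈ Finset.range L, β j * 2 ^ j = ∑ j ∈ Finset.range L, β' j * 2 ^ j) :
    ∀ j < L, β j = β' j := by
  induction L with
  | zero => intro j hj; omega
  | succ L ih =>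
    rw [Finset.sum_range_succ, Finset.sum_range_succ] at h
    have h1 := sum_bits_lt hβ L
    have h2 := sum_bits_lt hβ' L
    have h3 : β L = β' L := by
      have a1 := hβ L
      have a2 := hβ' L
      interval_cases β L <;> interval_cases β' L <;> first | rfl | omega
    rw [h3] at h
    intro j hj
    rcases Nat.lt_succ_iff_lt_or_eq.1 hj with hj | rfl
    · exact ih (by omega) j hj
    · exact h3

lemma sum_testBit (c L : ℕ) :
    ∑ j ∈ Finset.range L, (c.testBit j).toNat * 2 ^ j = c % 2 ^ L := by
  induction L with
  | zero => simp [Nat.mod_one]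
  | succ L ih => rw [Finset.sum_range_succ, ih, Nat.mod_pow_succ, Nat.toNat_testBit, mul_comm]

lemma sum_bits_eq_iff {β : ℕ → ℕ} (hβ : ∀ j, β j ≤ 1) (L c : ℕ) :
    ∑ j ∈ Finset.range L, β j * 2 ^ j = c ↔ c < 2 ^ L ∧ ∀ j < L, β j = (c.testBit j).toNat := by
  constructor
  · intro h
    have hc : c < 2 ^ L := h ▸ sum_bits_lt hβ L
    refine ⟨hc, sum_bits_inj hβ (fun j => Bool.toNat_le _) ?_⟩
    rw [h, sum_testBit, Nat.mod_eq_of_lt hc]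
  · rintro ⟨hc, h⟩
    rw [Finset.sum_congr rfl fun j hj => by rw [h j (Finset.mem_range.1 hj)], sum_testBit,
      Nat.mod_eq_of_lt hc]

lemma two_pow_clog_lt {k : ℕ} (hk : 0 < k) : 2 ^ Nat.clog 2 k < 2 * k := by
  rcases Nat.lt_or_ge 1 k with h | h
  · have h1 := Nat.pow_pred_clog_lt_self (b := 2) (by norm_num) h
    have h2 : 0 < Nat.clog 2 k := Nat.clog_pos (by norm_num) h
    obtain ⟨m, hm⟩ := Nat.exists_eq_succ_of_ne_zero h2.ne'
    rw [hm] at h1 ⊢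
    simp only [Nat.pred_succ] at h1
    rw [pow_succ]; omega
  · obtain rfl : k = 1 := by omega
    simp

/-- A number of `Nat.clog 2 k` bits is below 2k, so only t and t + k can have residue t. A residue
can thus be tested bit by bit with two flags, without storing the number. -/
lemma sum_bits_mod_eq_iff {β : ℕ → ℕ} (hβ : ∀ j, β j ≤ 1) {k t : ℕ} (ht : t < k) :
    (∑ j ∈ Finset.range (Nat.clog 2 k), β j * 2 ^ j) % k = t ↔
      (∀ j < Nat.clog 2 k, β j = (t.testBit j).toNat) ∨
      (t + k < 2 ^ Nat.clog 2 k ∧ ∀ j < Nat.clog 2 k, β j = ((t + k).testBit j).toNat) := by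
  have h1 := sum_bits_lt hβ (Nat.clog 2 k)
  have h2 := two_pow_clog_lt (k := k) (by omega)
  have h3 : k ≤ 2 ^ Nat.clog 2 k := Nat.le_pow_clog (by norm_num) k
  rw [← sum_bits_eq_iff hβ]
  have h4 : (∀ j < Nat.clog 2 k, β j = (t.testBit j).toNat) ↔
      ∑ j ∈ Finset.range (Nat.clog 2 k), β j * 2 ^ j = t := by
    rw [sum_bits_eq_iff hβ]
    exact ⟨fun h => ⟨by omega, h⟩, fun h => h.2⟩
  rw [h4]
  generalize ∑ j ∈ Finset.range (Nat.clog 2 k), β j * 2 ^ j = A at *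
  rcases Nat.lt_or_ge A k with h | h
  · rw [Nat.mod_eq_of_lt h]; omega
  · rw [Nat.mod_eq_sub_mod h, Nat.mod_eq_of_lt (by omega)]; omega

namespace SAF

lemma bit_le_one {n : ℕ} (x : Fin n → Bool) (m : ℕ) : bit x m ≤ 1 := by
  unfold bit; split_ifs
  · exact Bool.toNat_le _
  · omega

/-! ### The machine for the shuffled address function

A state consists of a flag telling whether the wanted block has been found, two flags used for
comparing the address of the current block with the two numbers of the given residue, and a
register with the wanted address (before the block is found) or its value (afterwards). If the
block has been found, the first of the two flags tells that the value is being computed. -/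

/-- The states of the machine. -/
abbrev ScanState : Type := Bool × Bool × Bool × Option ℕ

/-- Compare an address bit with those of two numbers. -/
def compareBit (c₁ c₂ : Option ℕ → ℕ) (j b : ℕ) (s : ScanState) : ScanState :=
  if s.1 then s else
    (false, s.2.1 && decide (b = ((c₁ s.2.2.2).testBit j).toNat),
      s.2.2.1 && decide (b = ((c₂ s.2.2.2).testBit j).toNat), s.2.2.2)

/-- Count a value bit. -/
def countBit (w b : ℕ) (s : ScanState) : ScanState :=
  if s.1 && s.2.1 then (true, true, false, s.2.2.2.map fun v => (v + b) % w) else s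

/-- Start a block. -/
def startBlock (k t : ℕ) (s : ScanState) : ScanState :=
  if s.1 then (true, false, false, s.2.2.2) else
    (false, true, decide (t + k < 2 ^ Nat.clog 2 k), s.2.2.2)

/-- Start the second part of an address. -/
def startAdrW (w : ℕ) (s : ScanState) : ScanState :=
  if s.1 then s else
    (false, (s.2.1 || s.2.2.1) && s.2.2.2.isSome,
      (s.2.1 || s.2.2.1) && s.2.2.2.isSome &&
        decide (s.2.2.2.getD 0 + 2 * w < 2 ^ Nat.clog 2 (2 * w)), s.2.2.2)

/-- Start the value of a block. -/
def startVal (s : ScanState) : ScanState :=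
  if s.1 then s else if s.2.1 || s.2.2.1 then (true, true, false, some 0) else s

/-- Read the `j`-th variable of a block when searching in step `t`. -/
def blockStep (k w t j b : ℕ) (s : ScanState) : ScanState :=
  if j < Nat.clog 2 k then
    compareBit (fun _ => t) (fun _ => t + k) j b (if j = 0 then startBlock k t s else s)
  else if j < addrLen k w then
    compareBit (fun r => r.getD 0) (fun r => r.getD 0 + 2 * w) (j - Nat.clog 2 k) b
      (if j - Nat.clog 2 k = 0 then startAdrW w s else s)
  else
    countBit w b (if j - addrLen k w = 0 then startVal s else s)

/-- End a layer: the value found becomes the next wanted address. -/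
def endLayer (w h : ℕ) (s : ScanState) : ScanState :=
  (false, false, false,
    if s.1 then s.2.2.2.map (fun v => if h = 0 then v % w + w else v % w) else none)

/-- Read a variable in a search. -/
def scanStep (n k w t m b : ℕ) (s : ScanState) : ScanState :=
  if m / blockLen n k w < 2 * k * w then blockStep k w t (m % blockLen n k w) b s else s

/-- The machine. Each step takes two layers; the layers that remain do nothing. -/
def scanMachine (n k w l m b : ℕ) (s : ScanState) : ScanState :=
  if l < 2 * k then
    (if m + 1 = n then endLayer w (l % 2) (scanStep n k w (l / 2) m b s)
      else scanStep n k w (l / 2) m b s)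
  else s

/-- The states that the machine uses. -/
def scanStates (w : ℕ) : Finset ScanState :=
  Finset.univ ×ˢ Finset.univ ×ˢ Finset.univ ×ˢ (Finset.range (2 * w)).insertNone

lemma card_scanStates (w : ℕ) : (scanStates w).card = 8 * (2 * w + 1) := by
  simp [scanStates]; ring

lemma mem_scanStates {w : ℕ} {s : ScanState} :
    s ∈ scanStates w ↔ ∀ v ∈ s.2.2.2, v < 2 * w := by
  simp [scanStates, Finset.mem_insertNone]

/-! ### Invariance of the set of states. -/

lemma mem_scanStates_of_reg_eq {w : ℕ} {s s' : ScanState} (hs : s ∈ scanStates w)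
    (h : s'.2.2.2 = s.2.2.2) : s' ∈ scanStates w := by
  rw [mem_scanStates, h]; exact mem_scanStates.1 hs

lemma compareBit_mem {w : ℕ} {c₁ c₂ : Option ℕ → ℕ} {j b : ℕ} {s : ScanState}
    (hs : s ∈ scanStates w) : compareBit c₁ c₂ j b s ∈ scanStates w := by
  unfold compareBit; split_ifs
  · exact hs
  · exact mem_scanStates_of_reg_eq hs rfl

lemma countBit_mem {w b : ℕ} (hw : 0 < w) {s : ScanState}
    (hs : s ∈ scanStates w) : countBit w b s ∈ scanStates w := by
  unfold countBit; split_ifs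
  · rw [mem_scanStates]
    intro v hv
    simp only [Option.mem_def, Option.map_eq_some_iff] at hv
    obtain ⟨a, -, rfl⟩ := hv
    have := Nat.mod_lt (a + b) hw
    omega
  · exact hs

lemma startBlock_mem {w k t : ℕ} {s : ScanState} (hs : s ∈ scanStates w) :
    startBlock k t s ∈ scanStates w := by
  unfold startBlock; split_ifs <;> exact mem_scanStates_of_reg_eq hs rfl

lemma startAdrW_mem {w : ℕ} {s : ScanState} (hs : s ∈ scanStates w) :
    startAdrW w s ∈ scanStates w := by
  unfold startAdrW; split_ifs <;> exact mem_scanStates_of_reg_eq hs rfl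

lemma startVal_mem {w : ℕ} (hw : 0 < w) {s : ScanState} (hs : s ∈ scanStates w) :
    startVal s ∈ scanStates w := by
  unfold startVal; split_ifs
  · exact hs
  · rw [mem_scanStates]; simpa using hw
  · exact hs

lemma blockStep_mem {k w t j b : ℕ} (hw : 0 < w) {s : ScanState} (hs : s ∈ scanStates w) :
    blockStep k w t j b s ∈ scanStates w := by
  unfold blockStep; split_ifs
  · exact compareBit_mem (startBlock_mem hs)
  · exact compareBit_mem hs
  · exact compareBit_mem (startAdrW_mem hs)
  · exact compareBit_mem hs
  · exact countBit_mem hw (startVal_mem hw hs)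
  · exact countBit_mem hw hs

lemma scanStep_mem {n k w t m b : ℕ} (hw : 0 < w) {s : ScanState} (hs : s ∈ scanStates w) :
    scanStep n k w t m b s ∈ scanStates w := by
  unfold scanStep; split_ifs
  · exact blockStep_mem hw hs
  · exact hs

/-- The reduction modulo w inside `endLayer` serves this bound for arbitrary states; a value that
was really found is already below w. -/
lemma endLayer_mem {w h : ℕ} (hw : 0 < w) (s : ScanState) : endLayer w h s ∈ scanStates w := by
  rw [mem_scanStates]
  intro v hv
  simp only [endLayer, Option.mem_def] at hv
  split_ifs at hv
  all_goals
    simp only [Option.map_eq_some_iff] at hv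
    obtain ⟨a, -, rfl⟩ := hv
    have := Nat.mod_lt a hw
    omega

lemma scanMachine_mem {n k w l m b : ℕ} (hw : 0 < w) {s : ScanState} (hs : s ∈ scanStates w) :
    scanMachine n k w l m b s ∈ scanStates w := by
  unfold scanMachine; split_ifs
  · exact endLayer_mem hw _
  · exact scanStep_mem hw hs
  · exact hs

/-! ### Runs of the machine over one block. -/

lemma iter_compareBit_done (c₁ c₂ : Option ℕ → ℕ) (β : ℕ → ℕ) (L : ℕ) {s : ScanState}
    (hs : s.1 = true) : iter (fun j => compareBit c₁ c₂ j (β j)) L s = s := by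
  induction L with
  | zero => rfl
  | succ L ih => simp only [iter]; rw [ih]; simp [compareBit, hs]

lemma iter_compareBit (c₁ c₂ : Option ℕ → ℕ) (β : ℕ → ℕ) (L : ℕ) (m₁ m₂ : Bool) (r : Option ℕ) :
    iter (fun j => compareBit c₁ c₂ j (β j)) L (false, m₁, m₂, r) =
      (false, m₁ && decide (∀ j < L, β j = ((c₁ r).testBit j).toNat),
        m₂ && decide (∀ j < L, β j = ((c₂ r).testBit j).toNat), r) := by
  induction L with
  | zero => simp [iter]
  | succ L ih =>
    simp only [iter]; rw [ih]
    simp only [compareBit, Nat.forall_lt_succ_right, Bool.decide_and, Bool.and_assoc]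
    rfl

lemma iter_countBit_skip (w : ℕ) (β : ℕ → ℕ) (L : ℕ) {s : ScanState} (hs : (s.1 && s.2.1) = false) :
    iter (fun j => countBit w (β j)) L s = s := by
  induction L with
  | zero => rfl
  | succ L ih => simp only [iter]; rw [ih]; simp [countBit, hs]

lemma iter_countBit (w : ℕ) (β : ℕ → ℕ) (L : ℕ) :
    iter (fun j => countBit w (β j)) L (true, true, false, some 0) =
      (true, true, false, some ((∑ j ∈ Finset.range L, β j) % w)) := by
  induction L with
  | zero => simp [iter]
  | succ L ih =>
    simp only [iter]; rw [ih]
    simp [countBit, Finset.sum_range_succ]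

/-- The three phases of a block can be separated because each reads at least one variable, which
carries its initialisation; this is where 2 ≤ k, 0 < w and 0 < V enter. -/
lemma iter_blockStep {k w t : ℕ} (hk : 2 ≤ k) (hw : 0 < w) {V : ℕ} (hV : 0 < V) (β : ℕ → ℕ)
    (s : ScanState) :
    iter (fun j => blockStep k w t j (β j)) (addrLen k w + V) s =
      iter (fun j => countBit w (β (addrLen k w + j))) V (startVal
        (iter (fun j => compareBit (fun r => r.getD 0) (fun r => r.getD 0 + 2 * w) j
            (β (Nat.clog 2 k + j))) (Nat.clog 2 (2 * w)) (startAdrW w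
          (iter (fun j => compareBit (fun _ => t) (fun _ => t + k) j (β j)) (Nat.clog 2 k)
            (startBlock k t s))))) := by
  have hL : 0 < Nat.clog 2 k := Nat.clog_pos (by norm_num) hk
  have hL' : 0 < Nat.clog 2 (2 * w) := Nat.clog_pos (by norm_num) (by omega)
  have e₁ : ∀ s, iter (fun j => blockStep k w t j (β j)) (Nat.clog 2 k) s =
      iter (fun j => compareBit (fun _ => t) (fun _ => t + k) j (β j)) (Nat.clog 2 k)
        (startBlock k t s) := by
    intro s
    rw [← iter_pre _ _ hL]
    refine iter_congr (fun j hj => ?_) _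
    funext s
    unfold blockStep
    rw [if_pos hj]
  have e₂ : ∀ s, iter (fun j => blockStep k w t (Nat.clog 2 k + j) (β (Nat.clog 2 k + j)))
      (Nat.clog 2 (2 * w)) s = iter (fun j => compareBit (fun r => r.getD 0)
        (fun r => r.getD 0 + 2 * w) j (β (Nat.clog 2 k + j))) (Nat.clog 2 (2 * w))
        (startAdrW w s) := by
    intro s
    rw [← iter_pre _ _ hL']
    refine iter_congr (fun j hj => ?_) _
    funext s
    unfold blockStep
    rw [if_neg (by omega), if_pos (by unfold addrLen; omega), Nat.add_sub_cancel_left]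
  have e₃ : ∀ s, iter (fun j => blockStep k w t (addrLen k w + j) (β (addrLen k w + j))) V s =
      iter (fun j => countBit w (β (addrLen k w + j))) V (startVal s) := by
    intro s
    rw [← iter_pre _ _ hV]
    refine iter_congr (fun j hj => ?_) _
    funext s
    unfold blockStep
    rw [if_neg (by unfold addrLen; omega), if_neg (by omega), Nat.add_sub_cancel_left]
  rw [iter_add, e₃]
  congr 2
  unfold addrLen
  rw [iter_add, e₂, e₁]

/-- The start of a new block clears the flag that enables counting. So later blocks with the same
address leave the value alone, and the lowest-numbered block wins. -/
lemma iter_blockStep_done {k w t : ℕ} (hk : 2 ≤ k) (hw : 0 < w) {V : ℕ} (hV : 0 < V) (β : ℕ → ℕ)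
    (m₁ m₂ : Bool) (r : Option ℕ) :
    iter (fun j => blockStep k w t j (β j)) (addrLen k w + V) (true, m₁, m₂, r) =
      (true, false, false, r) := by
  rw [iter_blockStep hk hw hV]
  have h1 : startBlock k t (true, m₁, m₂, r) = (true, false, false, r) := rfl
  have h2 : startAdrW w (true, false, false, r) = (true, false, false, r) := rfl
  have h3 : startVal (true, false, false, r) = (true, false, false, r) := rfl
  rw [h1, iter_compareBit_done (s := (true, false, false, r)) _ _ _ _ rfl, h2,
    iter_compareBit_done (s := (true, false, false, r)) _ _ _ _ rfl, h3,
    iter_countBit_skip _ _ _ rfl]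

/-- A lookup without a wanted address must fail: `startAdrW` drops both comparisons when the
register is empty. -/
lemma iter_blockStep_none {k w t : ℕ} (hk : 2 ≤ k) (hw : 0 < w) {V : ℕ} (hV : 0 < V) (β : ℕ → ℕ)
    (m₁ m₂ : Bool) :
    iter (fun j => blockStep k w t j (β j)) (addrLen k w + V) (false, m₁, m₂, none) =
      (false, false, false, none) := by
  rw [iter_blockStep hk hw hV]
  simp only [startBlock, Bool.false_eq_true, if_false, iter_compareBit, startAdrW,
    Option.isSome_none, Bool.and_false, Bool.false_and, startVal, Bool.or_false]
  exact iter_countBit_skip _ _ _ rfl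

lemma iter_blockStep_some {k w t i : ℕ} (hk : 2 ≤ k) (ht : t < k) (hi : i < 2 * w) {V : ℕ}
    (hV : 0 < V) (β : ℕ → ℕ) (hβ : ∀ j, β j ≤ 1) (m₁ m₂ : Bool) :
    iter (fun j => blockStep k w t j (β j)) (addrLen k w + V) (false, m₁, m₂, some i) =
      if (∑ j ∈ Finset.range (Nat.clog 2 k), β j * 2 ^ j) % k = t ∧
        (∑ j ∈ Finset.range (Nat.clog 2 (2 * w)), β (Nat.clog 2 k + j) * 2 ^ j) % (2 * w) = i
      then (true, true, false, some ((∑ j ∈ Finset.range V, β (addrLen k w + j)) % w))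
      else (false, false, false, some i) := by
  rw [iter_blockStep hk (by omega) hV]
  have hC := and_congr (sum_bits_mod_eq_iff hβ ht)
    (sum_bits_mod_eq_iff (β := fun j => β (Nat.clog 2 k + j)) (fun j => hβ _) hi)
  have hC' : (_ ∧ _) ↔ ((decide (∀ j < Nat.clog 2 k, β j = (t.testBit j).toNat) ||
        (decide (t + k < 2 ^ Nat.clog 2 k) &&
          decide (∀ j < Nat.clog 2 k, β j = ((t + k).testBit j).toNat))) &&
      (decide (∀ j < Nat.clog 2 (2 * w), β (Nat.clog 2 k + j) = (i.testBit j).toNat) ||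
        (decide (i + 2 * w < 2 ^ Nat.clog 2 (2 * w)) &&
          decide (∀ j < Nat.clog 2 (2 * w),
            β (Nat.clog 2 k + j) = ((i + 2 * w).testBit j).toNat)))) = true :=
    hC.trans (by simp only [Bool.and_eq_true, Bool.or_eq_true, decide_eq_true_eq])
  rw [if_congr hC' rfl rfl]
  simp only [startBlock, Bool.false_eq_true, if_false, iter_compareBit, startAdrW,
    Option.isSome_some, Bool.and_true, Bool.true_and, Option.getD_some]
  -- With the comparisons abstracted to Booleans, a finite case check remains.
  generalize decide (∀ j < Nat.clog 2 k, β j = (t.testBit j).toNat) = b₁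
  generalize (decide (t + k < 2 ^ Nat.clog 2 k) &&
          decide (∀ j < Nat.clog 2 k, β j = ((t + k).testBit j).toNat)) = b₂
  generalize decide (∀ j < Nat.clog 2 (2 * w), β (Nat.clog 2 k + j) = (i.testBit j).toNat) = b₃
  generalize decide (∀ j < Nat.clog 2 (2 * w),
    β (Nat.clog 2 k + j) = ((i + 2 * w).testBit j).toNat) = b₄
  generalize decide (i + 2 * w < 2 ^ Nat.clog 2 (2 * w)) = b₅
  rw [Bool.and_assoc (b₁ || b₂)]
  generalize (b₁ || b₂) = c₁
  generalize (b₅ && b₄) = c₂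
  cases c₁ <;> cases b₃ <;> cases c₂ <;>
    first
    | exact iter_countBit_skip _ _ _ rfl
    | exact iter_countBit w (fun j => β (addrLen k w + j)) V

/-! ### Runs over all blocks, over a layer, and over all steps. -/

lemma iter_scanStep_block {n k w t p : ℕ} (ha : addrLen k w < blockLen n k w) (x : Fin n → Bool)
    (hp : p < 2 * k * w) (s : ScanState) :
    iter (fun j => scanStep n k w t (p * blockLen n k w + j) (bit x (p * blockLen n k w + j)))
        (blockLen n k w) s =
      iter (fun j => blockStep k w t j (bit x (p * blockLen n k w + j)))
        (addrLen k w + valLen n k w) s := by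
  have hlen : addrLen k w + valLen n k w = blockLen n k w := by unfold valLen; omega
  rw [hlen]
  refine iter_congr (fun j hj => ?_) s
  funext s
  have h1 : (p * blockLen n k w + j) / blockLen n k w = p := by
    rw [mul_comm, Nat.mul_add_div (by omega), Nat.div_eq_of_lt hj, add_zero]
  have h2 : (p * blockLen n k w + j) % blockLen n k w = j := by
    rw [mul_comm, Nat.mul_add_mod, Nat.mod_eq_of_lt hj]
  unfold scanStep
  rw [h1, h2, if_pos hp]

/-- The result of the search among the first `p` blocks. -/
lemma iter_blocks {n k w t i : ℕ} (hk : 2 ≤ k) (ht : t < k) (hi : i < 2 * w)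
    (ha : addrLen k w < blockLen n k w) (x : Fin n → Bool) {p : ℕ} (hp : p ≤ 2 * k * w) :
    ∃ m₁ m₂, iter (fun m => scanStep n k w t m (bit x m)) (p * blockLen n k w)
      (false, false, false, some i) =
      match (List.range p).find? fun p => decide (adrK k w x p = t ∧ adrW k w x p = i) with
      | none => (false, m₁, m₂, some i)
      | some q => (true, m₁, m₂,
          some ((∑ j ∈ Finset.range (valLen n k w), valVar k w x q j) % w)) := by
  have hV : 0 < valLen n k w := by unfold valLen; omega
  induction p with
  | zero => exact ⟨false, false, by simp [iter]⟩
  | succ p ih =>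
    obtain ⟨m₁, m₂, h⟩ := ih (by omega)
    rw [add_mul, one_mul, iter_add, h, iter_scanStep_block ha x hp, List.range_succ, List.find?_append]
    cases hf : (List.range p).find? fun p => decide (adrK k w x p = t ∧ adrW k w x p = i) with
    | some q =>
      refine ⟨false, false, ?_⟩
      simp only [Option.some_or]
      exact iter_blockStep_done hk (by omega) hV _ _ _ _
    | none =>
      simp only [Option.none_or]
      rw [iter_blockStep_some hk ht hi hV (fun j => bit x (p * blockLen n k w + j))
        (fun j => bit_le_one _ _)]
      have e1 : (∑ j ∈ Finset.range (Nat.clog 2 k), bit x (p * blockLen n k w + j) * 2 ^ j) % k =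
          adrK k w x p := rfl
      have e2 : (∑ j ∈ Finset.range (Nat.clog 2 (2 * w)),
          bit x (p * blockLen n k w + (Nat.clog 2 k + j)) * 2 ^ j) % (2 * w) = adrW k w x p := by
        simp only [adrW, addrVar, add_comm]
      have e3 : (∑ j ∈ Finset.range (valLen n k w), bit x (p * blockLen n k w +
          (addrLen k w + j))) = ∑ j ∈ Finset.range (valLen n k w), valVar k w x p j := by
        simp only [valVar, add_assoc]
      rw [e1, e2, e3]
      by_cases hc : adrK k w x p = t ∧ adrW k w x p = i
      · exact ⟨true, false, by simp [hc]⟩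
      · exact ⟨false, false, by simp [hc]⟩

lemma iter_blocks_none {n k w t : ℕ} (hk : 2 ≤ k) (hw : 0 < w)
    (ha : addrLen k w < blockLen n k w) (x : Fin n → Bool) {p : ℕ} (hp : p ≤ 2 * k * w) :
    iter (fun m => scanStep n k w t m (bit x m)) (p * blockLen n k w)
      (false, false, false, none) = (false, false, false, none) := by
  have hV : 0 < valLen n k w := by unfold valLen; omega
  induction p with
  | zero => simp [iter]
  | succ p ih =>
    rw [add_mul, one_mul, iter_add, ih (by omega), iter_scanStep_block ha x hp, iter_blockStep_none hk hw hV]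

lemma val_lt {n k w i t v : ℕ} (hw : 0 < w) {x : Fin n → Bool} (h : val k w x i t = some v) :
    v < w := by
  simp only [val, Option.map_eq_some_iff] at h
  obtain ⟨p, -, rfl⟩ := h
  exact Nat.mod_lt _ hw

/-- A layer of the machine looks up a value. -/
lemma iter_scanMachine {n k w t h : ℕ} (hk : 2 ≤ k) (ht : t < k) (hw : 0 < w) (hh : h < 2)
    (ha : addrLen k w < blockLen n k w) (x : Fin n → Bool) (o : Option ℕ)
    (ho : ∀ i ∈ o, i < 2 * w) :
    iter (fun m => scanMachine n k w (2 * t + h) m (bit x m)) n (false, false, false, o) =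
      (false, false, false,
        (o.bind fun i => val k w x i t).map fun v => if h = 0 then v + w else v) := by
  have hle : 2 * k * w * blockLen n k w ≤ n := Nat.mul_div_le n _
  have hn : 0 < n := lt_of_lt_of_le 
    (Nat.mul_pos (Nat.mul_pos (by omega) hw) (by omega) : 0 < 2 * k * w * blockLen n k w) hle
  have hstep : ∀ m s, scanMachine n k w (2 * t + h) m (bit x m) s =
      if m + 1 = n then endLayer w h (scanStep n k w t m (bit x m) s)
        else scanStep n k w t m (bit x m) s := by
    intro m s
    unfold scanMachine
    rw [if_pos (by omega), show (2 * t + h) % 2 = h by omega, show (2 * t + h) / 2 = t by omega]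
  -- The layer is closed together with the reading of its last variable.
  have hend : iter (fun m => scanMachine n k w (2 * t + h) m (bit x m)) n (false, false, false, o) =
      endLayer w h (iter (fun m => scanStep n k w t m (bit x m)) n (false, false, false, o)) := by
    obtain ⟨n', hn'⟩ := Nat.exists_eq_succ_of_ne_zero hn.ne'
    have : ∀ (g : ℕ → ScanState → ScanState) (s), iter g n s = g n' (iter g n' s) := by
      intro g s; rw [hn']; rfl
    rw [this, this, hstep, if_pos hn'.symm]
    congr 2
    refine iter_congr (fun m hm => ?_) _
    funext s
    rw [hstep, if_neg (by omega)]
  -- The variables after the last block change nothing.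
  have hrest : iter (fun m => scanStep n k w t m (bit x m)) n (false, false, false, o) =
      iter (fun m => scanStep n k w t m (bit x m)) (2 * k * w * blockLen n k w)
        (false, false, false, o) := by
    obtain ⟨d, hd⟩ := Nat.exists_eq_add_of_le hle
    have : ∀ (g : ℕ → ScanState → ScanState) (s), iter g n s =
      iter g (2 * k * w * blockLen n k w + d) s := by
      intro g s; rw [← hd]
    rw [this, iter_add]
    refine iter_id (fun i s => ?_) _ _
    unfold scanStep
    rw [if_neg]
    rw [not_lt, Nat.le_div_iff_mul_le (by omega)]
    omega
  rw [hend, hrest]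
  cases o with
  | none =>
    rw [iter_blocks_none hk hw ha x le_rfl]
    rfl
  | some i =>
    obtain ⟨m₁, m₂, h'⟩ := iter_blocks hk ht (ho i rfl) ha x (le_refl (2 * k * w))
    rw [h']
    simp only [Option.bind_some, val, ind]
    cases (List.range (2 * k * w)).find? fun p => decide (adrK k w x p = t ∧ adrW k w x p = i) with
    | none => rfl
    | some q => simp [endLayer]

lemma step₂_lt {n k w t i : ℕ} (hw : 0 < w) {x : Fin n → Bool} (h : step₂ k w x t = some i) :
    i < w := by
  cases t with
  | zero => simp only [step₂, Option.some.injEq] at h; omega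
  | succ t =>
    simp only [step₂, Option.bind_eq_some_iff] at h
    obtain ⟨u, -, hu⟩ := h
    exact val_lt hw hu

lemma iter_layers {n k w t : ℕ} (hk : 2 ≤ k) (hw : 0 < w)
    (ha : addrLen k w < blockLen n k w) (x : Fin n → Bool) (ht : t ≤ k) :
    iter (fun l => iter (fun m => scanMachine n k w l m (bit x m)) n) (2 * t)
      (false, false, false, some 0) = (false, false, false, step₂ k w x t) := by
  induction t with
  | zero => rfl
  | succ t ih =>
    rw [show 2 * (t + 1) = 2 * t + 1 + 1 from rfl]
    have h0 := iter_scanMachine (h := 0) hk ht hw (by norm_num) ha x (step₂ k w x t)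
      (fun i hi => by have := step₂_lt hw hi; omega)
    have h1 := iter_scanMachine (h := 1) hk ht hw (by norm_num) ha x (step₁ k w x (step₂ k w x t) t)
      (fun i hi => by
        simp only [step₁, Option.mem_def, Option.bind_eq_some_iff, Option.map_eq_some_iff] at hi
        obtain ⟨_, -, v, hv, rfl⟩ := hi
        have := val_lt hw hv
        omega)
    simp only [iter]
    rw [ih (by omega)]
    rw [add_zero] at h0
    rw [h0]
    have e : ((step₂ k w x t).bind fun i => val k w x i t).map
        (fun v => if (0 : ℕ) = 0 then v + w else v) = step₁ k w x (step₂ k w x t) t := by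
      cases h : step₂ k w x t <;> simp [step₁]
    rw [e, h1]
    simp [step₂]

end SAF

/-- The shuffled address function is computed with two layers for each step. -/
theorem exists_POBDD_safFun {K k n w W : ℕ} (hk : 2 ≤ k) (hw : 0 < w) (hK : 2 * k ≤ K)
    (hW : 8 * (2 * w + 1) ≤ W) {δ : ℝ} (hδ : δ < 1 / 2) :
    ∃ P : POBDD K n W, P.Computes δ (safFun k w n) := by
  by_cases hn : 2 * k * w * (2 * w + Nat.clog 2 k + Nat.clog 2 (2 * w)) < n
  · have ha : SAF.addrLen k w < SAF.blockLen n k w := by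
      have h1 : 2 * w + Nat.clog 2 k + Nat.clog 2 (2 * w) ≤ SAF.blockLen n k w := by
        unfold SAF.blockLen
        rw [Nat.le_div_iff_mul_le (by positivity), mul_comm]
        exact hn.le
      unfold SAF.addrLen
      omega
    refine exists_POBDD_of_machine (SAF.scanStates w) ((SAF.card_scanStates w).trans_le hW)
      (SAF.scanMachine n k w) (fun i j b s hs => SAF.scanMachine_mem hw hs)
      (s₀ := (false, false, false, some 0)) (SAF.mem_scanStates.2 (by simpa using hw))
      (fun s => decide (0 < s.2.2.2.getD 0)) (fun x => ?_) hδ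
    obtain ⟨d, rfl⟩ := Nat.exists_eq_add_of_le hK
    rw [iter_add, SAF.iter_layers hk hw ha x le_rfl, iter_id]
    · simp [safFun, hn]
    · intro i s
      refine iter_id (fun m s => ?_) _ _
      unfold SAF.scanMachine
      rw [if_neg (by omega)]
  -- For the other n the function is constantly 0, and a single state is enough.
  · refine exists_POBDD_of_machine (T := Unit) Finset.univ (by simp; omega)
      (fun _ _ _ s => s) (fun _ _ _ _ _ => Finset.mem_univ _) (s₀ := ()) (Finset.mem_univ _)
      (fun _ => false) (fun x => ?_) hδ
    simp [safFun, hn]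

/-! ### Programs that have to distinguish many assignments -/

section RowNorm
open scoped Matrix.Norms.Operator

variable {v : ℕ}

/-- The maximal row sum is the fitting norm: it is submultiplicative, is at most 1 on stochastic
matrices, and bounds the change in the probability of any set of sinks. -/
lemma linfty_opNorm_le_iff {A : Matrix (Fin v) (Fin v) ℝ} {r : ℝ} (hr : 0 ≤ r) :
    ‖A‖ ≤ r ↔ ∀ i, ∑ j, |A i j| ≤ r := by
  lift r to NNReal using hr
  rw [Matrix.linfty_opNorm_def, NNReal.coe_le_coe, Finset.sup_le_iff]
  simp only [Finset.mem_univ, true_imp_iff, ← NNReal.coe_le_coe, NNReal.coe_sum, coe_nnnorm,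
    Real.norm_eq_abs]

lemma norm_le_one_of_mem_rowStochastic {A : Matrix (Fin v) (Fin v) ℝ}
    (hA : A ∈ Matrix.rowStochastic ℝ (Fin v)) : ‖A‖ ≤ 1 := by
  rw [linfty_opNorm_le_iff zero_le_one]
  intro i
  rw [Matrix.mem_rowStochastic_iff_sum] at hA
  rw [Finset.sum_congr rfl fun j _ => abs_of_nonneg (hA.1 i j), hA.2]

lemma norm_mul_sub_mul_le {A A' B B' : Matrix (Fin v) (Fin v) ℝ} (hA : ‖A‖ ≤ 1) (hB : ‖B'‖ ≤ 1) :
    ‖A * B - A' * B'‖ ≤ ‖A - A'‖ + ‖B - B'‖ := by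
  have h : A * B - A' * B' = (A - A') * B' + A * (B - B') := by noncomm_ring
  rw [h]
  refine (norm_add_le _ _).trans (add_le_add ?_ ?_)
  · exact (norm_mul_le _ _).trans (mul_le_of_le_one_right (norm_nonneg _) hB)
  · exact (norm_mul_le _ _).trans (mul_le_of_le_one_left (norm_nonneg _) hA)

/-- Replacing the factors one at a time, the errors only add up, since all other factors have norm
at most 1. -/
lemma norm_prod_sub_prod_le {K : ℕ} {M M' : Fin K → Matrix (Fin v) (Fin v) ℝ} {η : ℝ}
    (hM : ∀ i, M i ∈ Matrix.rowStochastic ℝ (Fin v))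
    (hM' : ∀ i, M' i ∈ Matrix.rowStochastic ℝ (Fin v)) (h : ∀ i, ‖M i - M' i‖ ≤ η) :
    ‖(List.ofFn M).prod - (List.ofFn M').prod‖ ≤ K * η := by
  induction K with
  | zero => simp
  | succ K ih =>
    rw [List.ofFn_succ, List.ofFn_succ, List.prod_cons, List.prod_cons]
    have hP : (List.ofFn fun i => M' (Fin.succ i)).prod ∈ Matrix.rowStochastic ℝ (Fin v) := by
      refine list_prod_mem fun x hx => ?_
      obtain ⟨i, rfl⟩ := (List.mem_ofFn' _ _).1 hx
      exact hM' _
    refine (norm_mul_sub_mul_le (norm_le_one_of_mem_rowStochastic (hM 0))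
      (norm_le_one_of_mem_rowStochastic hP)).trans ?_
    have := ih (fun i => hM i.succ) (fun i => hM' i.succ) (fun i => h i.succ)
    have := h 0
    push_cast
    linarith

lemma abs_sum_row_le_norm (A : Matrix (Fin v) (Fin v) ℝ) (s : Fin v) (T : Finset (Fin v)) :
    |∑ t ∈ T, A s t| ≤ ‖A‖ :=
  (Finset.abs_sum_le_sum_abs _ _).trans
    ((Finset.sum_le_sum_of_subset_of_nonneg (Finset.subset_univ _) fun _ _ _ => abs_nonneg _).trans
      ((linfty_opNorm_le_iff (norm_nonneg A)).1 le_rfl s))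

lemma norm_sub_le_of_floor_eq {q : ℕ} (hq : 0 < q) {A A' : Matrix (Fin v) (Fin v) ℝ}
    (hA : ∀ i j, 0 ≤ A i j) (hA' : ∀ i j, 0 ≤ A' i j)
    (h : ∀ i j, ⌊A i j * q⌋₊ = ⌊A' i j * q⌋₊) : ‖A - A'‖ ≤ v / q := by
  have hq' : (0 : ℝ) < q := by exact_mod_cast hq
  rw [linfty_opNorm_le_iff (by positivity)]
  intro i
  have : ∀ j ∈ Finset.univ, |(A - A') i j| ≤ 1 / q := by
    intro j _
    have h1 := Nat.floor_le (mul_nonneg (hA i j) hq'.le)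
    have h2 := Nat.lt_floor_add_one (A i j * q)
    have h3 := Nat.floor_le (mul_nonneg (hA' i j) hq'.le)
    have h4 := Nat.lt_floor_add_one (A' i j * q)
    rw [h i j] at h1 h2
    have h5 : |(A i j - A' i j) * q| ≤ 1 := by
      rw [sub_mul, abs_le]
      constructor <;> linarith
    rw [abs_mul, abs_of_pos hq'] at h5
    rwa [Matrix.sub_apply, le_div_iff₀ hq']
  refine (Finset.sum_le_card_nsmul _ _ _ this).trans ?_
  simp [div_eq_mul_inv]

/-- A program whose variables are split at a position of the order into a part that depends on `c`
and a part that depends on `b`: the values `c` that have to be distinguished are no more than the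
cells of a grid on the transition matrices of the first part. -/
theorem POBDD.card_le_of_separated {K n : ℕ} (P : POBDD K n v) {δ : ℝ} (hδ : 0 < δ)
    {f : (Fin n → Bool) → Bool} (hP : P.Computes δ f) {ι κ : Type*} [Fintype ι] [Nonempty ι]
    [Nonempty κ] (X : ι → κ → Fin n → Bool) (l : ℕ)
    (hA : ∀ c b b' (j : Fin n), (j : ℕ) < l → X c b (P.order j) = X c b' (P.order j))
    (hB : ∀ c c' b (j : Fin n), l ≤ (j : ℕ) → X c b (P.order j) = X c' b (P.order j))
    (hsep : ∀ c c', c ≠ c' → ∃ b, f (X c b) ≠ f (X c' b)) :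
    Fintype.card ι ≤ (⌈(K * v : ℝ) / (2 * δ)⌉₊ + 2) ^ (K * v ^ 2) := by
  classical
  -- Chosen so that K v / q ≤ 2δ; the added 1 keeps q positive when K v = 0. Entries in [0, 1] then
  -- fall into the q + 1 cells 0, …, q.
  set q : ℕ := ⌈(K * v : ℝ) / (2 * δ)⌉₊ + 1 with hq
  have hq' : (0 : ℝ) < q := by rw [hq]; positivity
  obtain ⟨c₀⟩ := ‹Nonempty ι›
  obtain ⟨b₀⟩ := ‹Nonempty κ›
  let E : Fin K → ι → κ → List (Matrix (Fin v) (Fin v) ℝ) :=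
    fun i c b => List.ofFn fun j => P.trans i j (X c b (P.order j))
  have hE : ∀ i c b, ∀ M ∈ E i c b, M ∈ Matrix.rowStochastic ℝ (Fin v) := by
    intro i c b M hM
    obtain ⟨j, rfl⟩ := (List.mem_ofFn' _ _).1 hM
    exact P.trans_stochastic _ _ _
  -- The fixed `b₀` and `c₀` are arbitrary: by `hA` and `hB` the two factors do not depend on them.
  let A : ι → Fin K → Matrix (Fin v) (Fin v) ℝ := fun c i => ((E i c b₀).take l).prod
  let B : κ → Fin K → Matrix (Fin v) (Fin v) ℝ := fun b i => ((E i c₀ b).drop l).prod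
  have hAs : ∀ c i, A c i ∈ Matrix.rowStochastic ℝ (Fin v) := fun c i =>
    list_prod_mem fun M hM => hE _ _ _ _ (List.mem_of_mem_take hM)
  have hBs : ∀ c i, B c i ∈ Matrix.rowStochastic ℝ (Fin v) := fun c i =>
    list_prod_mem fun M hM => hE _ _ _ _ (List.mem_of_mem_drop hM)
  have hlayer : ∀ i c b, P.layerMatrix i (X c b) = A c i * B b i := by
    intro i c b
    have h1 : (E i c b).take l = (E i c b₀).take l := by
      refine List.ext_getElem (by simp [E]) fun m h1 h2 => ?_
      simp only [List.length_take, lt_min_iff] at h1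
      simp only [List.getElem_take, E, List.getElem_ofFn]
      rw [hA c b b₀ _ h1.1]
    have h2 : (E i c b).drop l = (E i c₀ b).drop l := by
      refine List.ext_getElem (by simp [E]) fun m h1 h2 => ?_
      simp only [List.getElem_drop, E, List.getElem_ofFn]
      rw [hB c c₀ b _ (by simp)]
    calc P.layerMatrix i (X c b) = (E i c b).prod := rfl
      _ = ((E i c b).take l ++ (E i c b).drop l).prod := by rw [List.take_append_drop]
      _ = A c i * B b i := by rw [List.prod_append, h1, h2]
  let cell : ι → (Fin K × Fin v × Fin v → Fin (q + 1)) := fun c p =>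
    ⟨⌊A c p.1 p.2.1 p.2.2 * q⌋₊, by
      have h1 := Matrix.le_one_of_mem_rowStochastic (hAs c p.1) (i := p.2.1) (j := p.2.2)
      have h2 : A c p.1 p.2.1 p.2.2 * q ≤ q := mul_le_of_le_one_left hq'.le h1
      exact Nat.lt_succ_of_le (Nat.floor_le_of_le h2)⟩
  have hinj : Function.Injective cell := by
    intro c c' hcc
    by_contra hne
    obtain ⟨b, hb⟩ := hsep c c' hne
    have hclose : ∀ i, ‖A c i - A c' i‖ ≤ v / q := by
      intro i
      refine norm_sub_le_of_floor_eq (by omega)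
        (fun a a' => Matrix.nonneg_of_mem_rowStochastic (hAs c i))
        (fun a a' => Matrix.nonneg_of_mem_rowStochastic (hAs c' i)) fun a a' => ?_
      exact congrArg Fin.val (congrFun hcc (i, a, a'))
    have hlc : ∀ i, ‖P.layerMatrix i (X c b) - P.layerMatrix i (X c' b)‖ ≤ v / q := by
      intro i
      rw [hlayer, hlayer, ← sub_mul]
      exact (norm_mul_le _ _).trans ((mul_le_of_le_one_right (norm_nonneg _)
        (norm_le_one_of_mem_rowStochastic (hBs b i))).trans (hclose i))
    have hls : ∀ c i, P.layerMatrix i (X c b) ∈ Matrix.rowStochastic ℝ (Fin v) := by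
      intro c i
      rw [hlayer]
      exact mul_mem (hAs c i) (hBs b i)
    have htot : ‖P.totalMatrix (X c b) - P.totalMatrix (X c' b)‖ ≤ K * (v / q) :=
      norm_prod_sub_prod_le (hls c) (hls c') hlc
    have hacc : |P.acceptProb (X c b) - P.acceptProb (X c' b)| ≤ K * (v / q) := by
      refine le_trans ?_ htot
      unfold POBDD.acceptProb
      rw [← Finset.sum_sub_distrib]
      simpa only [Matrix.sub_apply] using abs_sum_row_le_norm
        (P.totalMatrix (X c b) - P.totalMatrix (X c' b)) P.source P.accept
    have hsmall : (K : ℝ) * (v / q) ≤ 2 * δ := by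
      rw [← mul_div_assoc, div_le_iff₀ hq']
      have h1 : (K * v : ℝ) / (2 * δ) ≤ q := by
        rw [hq]; push_cast
        linarith [Nat.le_ceil ((K * v : ℝ) / (2 * δ))]
      rw [div_le_iff₀ (by positivity)] at h1
      linarith
    -- Inputs with different values have acceptance probabilities more than 2δ apart, which
    -- contradicts `hacc` and `hsmall`.
    rw [abs_le] at hacc
    cases h : f (X c b) <;> cases h' : f (X c' b)
    · exact hb (h.trans h'.symm)
    · have := (hP _).2 h
      have := (hP _).1 h'
      linarith
    · have := (hP _).1 h
      have := (hP _).2 h'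
      linarith
    · exact hb (h.trans h'.symm)
  have := Fintype.card_le_of_injective cell hinj
  simp only [Fintype.card_fun, Fintype.card_prod, Fintype.card_fin] at this
  rw [hq] at this
  rwa [pow_two]

end RowNorm

namespace SAF

/-! ### Hard inputs for the shuffled address function -/

/-- The input whose block `p` has the address `adr p` and the value `v p`. -/
def blockInput (n k w : ℕ) (adr : ℕ → ℕ × ℕ) (v : ℕ → ℕ) : Fin n → Bool := fun m =>
  if (m : ℕ) % blockLen n k w < Nat.clog 2 k then
    (adr (m / blockLen n k w)).1.testBit (m % blockLen n k w)
  else if (m : ℕ) % blockLen n k w < addrLen k w then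
    (adr (m / blockLen n k w)).2.testBit (m % blockLen n k w - Nat.clog 2 k)
  else decide (m % blockLen n k w - addrLen k w < v (m / blockLen n k w))

section
variable {n k w : ℕ} {adr : ℕ → ℕ × ℕ} {v : ℕ → ℕ} {p j : ℕ}

lemma block_lt (hp : p < 2 * k * w) (hj : j < blockLen n k w) : p * blockLen n k w + j < n := by
  have h1 : 2 * k * w * blockLen n k w ≤ n := Nat.mul_div_le n _
  have h2 : (p + 1) * blockLen n k w ≤ 2 * k * w * blockLen n k w := Nat.mul_le_mul_right _ hp
  rw [add_mul] at h2
  omega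

lemma bit_blockInput (hp : p < 2 * k * w) (hj : j < blockLen n k w) :
    bit (blockInput n k w adr v) (p * blockLen n k w + j) =
      (if j < Nat.clog 2 k then (adr p).1.testBit j else if j < addrLen k w then
        (adr p).2.testBit (j - Nat.clog 2 k) else decide (j - addrLen k w < v p)).toNat := by
  have h1 : (p * blockLen n k w + j) / blockLen n k w = p := by
    rw [mul_comm, Nat.mul_add_div (by omega), Nat.div_eq_of_lt hj, add_zero]
  have h2 : (p * blockLen n k w + j) % blockLen n k w = j := by
    rw [mul_comm, Nat.mul_add_mod, Nat.mod_eq_of_lt hj]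
  rw [bit, dif_pos (block_lt hp hj), blockInput]
  simp only [h1, h2]

lemma adrK_blockInput (ha : addrLen k w ≤ blockLen n k w) (hp : p < 2 * k * w)
    (h : (adr p).1 < k) : adrK k w (blockInput n k w adr v) p = (adr p).1 := by
  have h1 : (adr p).1 < 2 ^ Nat.clog 2 k := h.trans_le (Nat.le_pow_clog (by norm_num) k)
  unfold adrK addrVar
  rw [Finset.sum_congr rfl (g := fun j => ((adr p).1.testBit j).toNat * 2 ^ j)]
  · rw [sum_testBit, Nat.mod_eq_of_lt h1, Nat.mod_eq_of_lt h]
  · intro j hj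
    rw [Finset.mem_range] at hj
    rw [bit_blockInput hp (by unfold addrLen at ha; omega), if_pos hj]

lemma adrW_blockInput (ha : addrLen k w ≤ blockLen n k w) (hp : p < 2 * k * w)
    (h : (adr p).2 < 2 * w) : adrW k w (blockInput n k w adr v) p = (adr p).2 := by
  have h1 : (adr p).2 < 2 ^ Nat.clog 2 (2 * w) := h.trans_le (Nat.le_pow_clog (by norm_num) _)
  unfold adrW addrVar
  rw [Finset.sum_congr rfl (g := fun j => ((adr p).2.testBit j).toNat * 2 ^ j)]
  · rw [sum_testBit, Nat.mod_eq_of_lt h1, Nat.mod_eq_of_lt h]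
  · intro j hj
    rw [Finset.mem_range] at hj
    rw [bit_blockInput hp (by unfold addrLen at ha; omega), if_neg (by omega),
      if_pos (by unfold addrLen; omega), Nat.add_sub_cancel]

lemma sum_valVar_blockInput (hp : p < 2 * k * w) (h : v p ≤ valLen n k w) :
    ∑ j ∈ Finset.range (valLen n k w), valVar k w (blockInput n k w adr v) p j = v p := by
  unfold valVar
  rw [Finset.sum_congr rfl (g := fun j => if j < v p then 1 else 0)]
  · rw [Finset.sum_boole]
    have : (Finset.range (valLen n k w)).filter (fun j => j < v p) = Finset.range (v p) := by
      ext j; simp; omega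
    rw [this]; simp
  · intro j hj
    rw [Finset.mem_range] at hj
    rw [add_assoc, bit_blockInput hp (by unfold valLen at hj; omega),
      if_neg (by unfold addrLen; omega), if_neg (by omega), Nat.add_sub_cancel_left]
    by_cases hjv : j < v p <;> simp [hjv]

lemma val_blockInput (ha : addrLen k w ≤ blockLen n k w)
    (h1 : ∀ p < 2 * k * w, (adr p).1 < k) (h2 : ∀ p < 2 * k * w, (adr p).2 < 2 * w)
    (hv : ∀ p < 2 * k * w, v p ≤ valLen n k w) {i t q : ℕ} (hq : q < 2 * k * w)
    (hqa : adr q = (t, i)) (huniq : ∀ p < 2 * k * w, adr p = (t, i) → p = q) :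
    val k w (blockInput n k w adr v) i t = some (v q % w) := by
  have hind : ind k w (blockInput n k w adr v) i t = some q := by
    unfold ind
    rw [List.find?_range_eq_some]
    refine ⟨?_, List.mem_range.2 hq, fun p hp => ?_⟩
    · rw [decide_eq_true_iff, adrK_blockInput ha hq (h1 q hq), adrW_blockInput ha hq (h2 q hq), hqa]
      exact ⟨rfl, rfl⟩
    · have hp' : p < 2 * k * w := hp.trans hq
      rw [Bool.not_eq_true', decide_eq_false_iff_not, adrK_blockInput ha hp' (h1 p hp'),
        adrW_blockInput ha hp' (h2 p hp')]
      rintro ⟨e1, e2⟩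
      exact hp.ne (huniq p hp' (Prod.ext e1 e2))
  rw [val, hind, Option.map_some, sum_valVar_blockInput hq (hv q hq)]

end

/-! ### The hard inputs and their evaluation. -/

/-- The address of block `p` in the hard inputs. The first `2k` blocks are controlled: in the
order given by `σ`, the first `k` of them by one side and the last `k` by the other. -/
def hardAdr (k w : ℕ) (σ : Equiv.Perm (Fin (2 * k))) (p : ℕ) : ℕ × ℕ :=
  if h : p < 2 * k then
    (if (σ.symm ⟨p, h⟩ : ℕ) < k then ((σ.symm ⟨p, h⟩ : ℕ), 1) else (σ.symm ⟨p, h⟩ - k, w))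
  else if p < 3 * k then (p - 2 * k, 0) else if p < 4 * k then (p - 3 * k, 2)
  -- Surplus blocks get an address that is never looked up; for w ≥ 4 it differs from all those in
  -- use.
  else if p < 5 * k then (p - 4 * k, w + 1) else (0, 3)

/-- The value of block `p` in the hard inputs. -/
def hardVal (k : ℕ) (σ : Equiv.Perm (Fin (2 * k))) (c b : ℕ → Bool) (p : ℕ) : ℕ :=
  if h : p < 2 * k then
    (if (σ.symm ⟨p, h⟩ : ℕ) < k then (c (σ.symm ⟨p, h⟩)).toNat
      else (b (σ.symm ⟨p, h⟩ - k)).toNat)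
  else if p < 3 * k then 0 else if p < 4 * k then 1 else if p < 5 * k then 2 else 0

/-- The hard inputs. -/
def hardInput (n k w : ℕ) (σ : Equiv.Perm (Fin (2 * k))) (c b : ℕ → Bool) : Fin n → Bool :=
  blockInput n k w (hardAdr k w σ) (hardVal k σ c b)

section
variable {n k w : ℕ} {σ : Equiv.Perm (Fin (2 * k))} {c b : ℕ → Bool}

lemma hardVal_le_two (p : ℕ) : hardVal k σ c b p ≤ 2 := by
  unfold hardVal
  split_ifs <;> first | omega | exact (Bool.toNat_le _).trans one_le_two

lemma val_hardInput (hw : 4 ≤ w) (ha : addrLen k w + 2 ≤ blockLen n k w) {i t q : ℕ}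
    (hq : q < 5 * k)
    (hqa : hardAdr k w σ q = (t, i)) (huniq : ∀ p, hardAdr k w σ p = (t, i) → p = q) :
    val k w (hardInput n k w σ c b) i t = some (hardVal k σ c b q) := by
  have hq' : q < 2 * k * w := by nlinarith
  have h := val_blockInput (n := n) (k := k) (w := w) (adr := hardAdr k w σ)
    (v := hardVal k σ c b) (by omega) ?_ ?_
    (fun p _ => (hardVal_le_two p).trans (by unfold valLen; omega)) hq' hqa (fun p _ => huniq p)
  · rwa [Nat.mod_eq_of_lt ((hardVal_le_two q).trans_lt (by omega))] at h
  · intro p _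
    unfold hardAdr
    split_ifs <;> simp only <;> omega
  · intro p _
    unfold hardAdr
    split_ifs <;> simp only <;> omega

lemma val_hardInput_zero (hw : 4 ≤ w) (ha : addrLen k w + 2 ≤ blockLen n k w) {t : ℕ}
    (ht : t < k) : val k w (hardInput n k w σ c b) 0 t = some 0 := by
  rw [val_hardInput hw ha (q := 2 * k + t) (by omega)]
  · unfold hardVal
    rw [dif_neg (by omega), if_pos (by omega)]
  · unfold hardAdr
    rw [dif_neg (by omega), if_pos (by omega), Nat.add_sub_cancel_left]
  · intro p hp
    unfold hardAdr at hp
    split_ifs at hp <;> simp only [Prod.mk.injEq] at hp <;> omega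

lemma val_hardInput_two (hw : 4 ≤ w) (ha : addrLen k w + 2 ≤ blockLen n k w) {t : ℕ}
    (ht : t < k) : val k w (hardInput n k w σ c b) 2 t = some 1 := by
  rw [val_hardInput hw ha (q := 3 * k + t) (by omega)]
  · unfold hardVal
    rw [dif_neg (by omega), if_neg (by omega), if_pos (by omega)]
  · unfold hardAdr
    rw [dif_neg (by omega), if_neg (by omega), if_pos (by omega), Nat.add_sub_cancel_left]
  · intro p hp
    unfold hardAdr at hp
    split_ifs at hp <;> simp only [Prod.mk.injEq] at hp <;> omega

lemma val_hardInput_add_one (hw : 4 ≤ w) (ha : addrLen k w + 2 ≤ blockLen n k w) {t : ℕ}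
    (ht : t < k) : val k w (hardInput n k w σ c b) (w + 1) t = some 2 := by
  rw [val_hardInput hw ha (q := 4 * k + t) (by omega)]
  · unfold hardVal
    rw [dif_neg (by omega), if_neg (by omega), if_neg (by omega), if_pos (by omega)]
  · unfold hardAdr
    rw [dif_neg (by omega), if_neg (by omega), if_neg (by omega), if_pos (by omega),
      Nat.add_sub_cancel_left]
  · intro p hp
    unfold hardAdr at hp
    split_ifs at hp <;> simp only [Prod.mk.injEq] at hp <;> omega

lemma val_hardInput_one (hw : 4 ≤ w) (ha : addrLen k w + 2 ≤ blockLen n k w) {t : ℕ}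
    (ht : t < k) : val k w (hardInput n k w σ c b) 1 t = some (c t).toNat := by
  have hlt := (σ ⟨t, by omega⟩).2
  rw [val_hardInput hw ha (q := σ ⟨t, by omega⟩) (by omega)]
  · unfold hardVal
    simp [ht]
  · unfold hardAdr
    simp [ht]
  · intro p hp
    unfold hardAdr at hp
    split_ifs at hp with h1 <;> simp only [Prod.mk.injEq] at hp <;> first | omega | skip
    have : σ.symm ⟨p, h1⟩ = ⟨t, by omega⟩ := Fin.ext hp.1
    rw [← this]; simp

lemma val_hardInput_self (hw : 4 ≤ w) (ha : addrLen k w + 2 ≤ blockLen n k w) {t : ℕ}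
    (ht : t < k) : val k w (hardInput n k w σ c b) w t = some (b t).toNat := by
  have hlt := (σ ⟨k + t, by omega⟩).2
  rw [val_hardInput hw ha (q := σ ⟨k + t, by omega⟩) (by omega)]
  · unfold hardVal
    simp
  · unfold hardAdr
    simp
  · intro p hp
    unfold hardAdr at hp
    split_ifs at hp with h1 <;> simp only [Prod.mk.injEq] at hp <;> first | omega | skip
    have : σ.symm ⟨p, h1⟩ = ⟨k + t, by omega⟩ := Fin.ext (by simp only; omega)
    rw [← this]; simp

/-- From outcome 0 the second lookup goes to w, which holds b_t. From 1 the first lookup reads c_t,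
and the second goes to w (value b_t) or w + 1 (value 2). From 2 it always goes to w + 1, so 2 is
absorbing. -/
lemma step₂_hardInput_succ (hw : 4 ≤ w) (ha : addrLen k w + 2 ≤ blockLen n k w) {t : ℕ}
    (ht : t < k) :
    (step₂ k w (hardInput n k w σ c b) t = some 0 →
      step₂ k w (hardInput n k w σ c b) (t + 1) = some (b t).toNat) ∧
    (step₂ k w (hardInput n k w σ c b) t = some 1 →
      step₂ k w (hardInput n k w σ c b) (t + 1) = some (if c t then 2 else (b t).toNat)) ∧
    (step₂ k w (hardInput n k w σ c b) t = some 2 →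
      step₂ k w (hardInput n k w σ c b) (t + 1) = some 2) := by
  refine ⟨fun h => ?_, fun h => ?_, fun h => ?_⟩
  · simp [step₂, step₁, h, val_hardInput_zero hw ha ht, val_hardInput_self hw ha ht]
  · cases hc : c t <;>
      simp [step₂, step₁, h, val_hardInput_one hw ha ht, val_hardInput_self hw ha ht, hc,
        add_comm 1 w, val_hardInput_add_one hw ha ht]
  · simp [step₂, step₁, h, val_hardInput_two hw ha ht, add_comm 1 w,
      val_hardInput_add_one hw ha ht]

/-- If `b` is `1` only at `T`, then the outcome tells the value of `c` at `T + 1`. -/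
lemma step₂_hardInput (hw : 4 ≤ w) (ha : addrLen k w + 2 ≤ blockLen n k w) {T : ℕ}
    (hT : T + 1 < k) :
    step₂ k w (hardInput n k w σ c fun t => decide (t = T)) k =
      some (if c (T + 1) then 2 else 0) := by
  set x := hardInput n k w σ c fun t => decide (t = T) with hx
  have h0 : ∀ t ≤ T, step₂ k w x t = some 0 := by
    intro t ht
    induction t with
    | zero => rfl
    | succ t ih =>
      rw [(step₂_hardInput_succ hw ha (by omega)).1 (ih (by omega))]
      simp; omega
  have h1 : step₂ k w x (T + 1) = some 1 := by
    rw [(step₂_hardInput_succ hw ha (by omega)).1 (h0 T le_rfl)]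
    simp
  -- Step T + 1 decides. Afterwards 2 is absorbing, and 0 persists because b vanishes after T.
  have h2 : ∀ d, T + 2 + d ≤ k → step₂ k w x (T + 2 + d) = some (if c (T + 1) then 2 else 0) := by
    intro d hd
    induction d with
    | zero =>
      rw [add_zero, (step₂_hardInput_succ hw ha (by omega)).2.1 h1]
      simp
    | succ d ih =>
      have ih := ih (by omega)
      rw [← add_assoc]
      split_ifs at ih ⊢ with hc
      · exact (step₂_hardInput_succ hw ha (by omega)).2.2 ih
      · rw [(step₂_hardInput_succ hw ha (by omega)).1 ih]
        simp; omega
  obtain ⟨d, hd⟩ := Nat.exists_eq_add_of_le (show T + 2 ≤ k by omega)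
  have := h2 d hd.ge
  rwa [← hd] at this

/-- A variable that depends on the values controlled by one of the sides is the first value
variable of a block of that side. -/
lemma exists_of_hardInput_ne {c' b' : ℕ → Bool} {m : Fin n}
    (h : hardInput n k w σ c b m ≠ hardInput n k w σ c' b' m) :
    ∃ p : Fin (2 * k), (m : ℕ) = p * blockLen n k w + addrLen k w ∧
      (b = b' → (σ.symm p : ℕ) < k) ∧ (c = c' → k ≤ (σ.symm p : ℕ)) := by
  unfold hardInput blockInput at h
  split_ifs at h with h1 h2
  · exact absurd rfl h
  · exact absurd rfl h
  have hne : hardVal k σ c b (m / blockLen n k w) ≠ hardVal k σ c' b' (m / blockLen n k w) :=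
    fun e => h (by rw [e])
  have hp : (m : ℕ) / blockLen n k w < 2 * k := by
    by_contra hp
    unfold hardVal at hne
    rw [dif_neg hp, dif_neg hp] at hne
    exact hne rfl
  have hle : ∀ c b, hardVal k σ c b (m / blockLen n k w) ≤ 1 := by
    intro c b
    unfold hardVal
    rw [dif_pos hp]
    split_ifs <;> exact Bool.toNat_le _
  refine ⟨⟨_, hp⟩, ?_, ?_, ?_⟩
  · have hm : (m : ℕ) % blockLen n k w - addrLen k w = 0 := by
      by_contra hm
      have e1 := hle c b
      have e2 := hle c' b'
      rw [decide_eq_false (by omega), decide_eq_false (by omega)] at h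
      exact h rfl
    have := Nat.div_add_mod' m (blockLen n k w)
    simp only
    omega
  · rintro rfl
    by_contra hlt
    unfold hardVal at hne
    rw [dif_pos hp, dif_pos hp, if_neg hlt, if_neg hlt] at hne
    exact hne rfl
  · rintro rfl
    by_contra hlt
    unfold hardVal at hne
    rw [dif_pos hp, dif_pos hp, if_pos (not_le.1 hlt), if_pos (not_le.1 hlt)] at hne
    exact hne rfl

end

/-- For every order of the variables there are many assignments of the variables read first that
the shuffled address function has to distinguish. -/
theorem exists_separated_inputs {n k w : ℕ} (hw : 4 ≤ w)
    (hn : 2 * k * w * (2 * w + Nat.clog 2 k + Nat.clog 2 (2 * w)) < n) (hk : 2 ≤ k)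
    (θ : Equiv.Perm (Fin n)) :
    ∃ (X : (Fin (k - 1) → Bool) → Fin (k - 1) → Fin n → Bool) (l : ℕ),
      (∀ c b b' (j : Fin n), (j : ℕ) < l → X c b (θ j) = X c b' (θ j)) ∧
      (∀ c c' b (j : Fin n), l ≤ (j : ℕ) → X c b (θ j) = X c' b (θ j)) ∧
      ∀ c c', c ≠ c' → ∃ b, safFun k w n (X c b) ≠ safFun k w n (X c' b) := by
  have ha : addrLen k w + 2 ≤ blockLen n k w := by
    have h1 : 2 * w + Nat.clog 2 k + Nat.clog 2 (2 * w) ≤ blockLen n k w := by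
      unfold blockLen
      rw [Nat.le_div_iff_mul_le (by positivity), mul_comm]
      exact hn.le
    unfold addrLen
    omega
  have hlt : ∀ p : Fin (2 * k), (p : ℕ) * blockLen n k w + addrLen k w < n := fun p =>
    block_lt (k := k) (w := w) (by nlinarith [p.2]) (by omega)
  let key : Fin (2 * k) → Fin n := fun p => θ.symm ⟨_, hlt p⟩
  have hkey : Function.Injective key := by
    intro p p' h
    have h' := congrArg Fin.val (θ.symm.injective h)
    simp only at h'
    exact Fin.ext (Nat.eq_of_mul_eq_mul_right (by omega : 0 < blockLen n k w) (by omega))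
  -- The controlled blocks are sorted by the time at which their only varying variable is read, so
  -- that all of c comes before all of b.
  let σ : Equiv.Perm (Fin (2 * k)) := Tuple.sort key
  have hσ : StrictMono (key ∘ σ) :=
    (Tuple.monotone_sort key).strictMono_of_injective (hkey.comp σ.injective)
  have hkeyθ : ∀ (j : Fin n) (p : Fin (2 * k)),
      ((θ j : Fin n) : ℕ) = p * blockLen n k w + addrLen k w → j = key p := by
    intro j p h
    rw [Equiv.eq_symm_apply]
    exact Fin.ext h
  -- The bits are shifted by one: the run enters step 0 with outcome 0, so bit 0 is never consulted
  -- and k - 1 bits are free.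
  let ext : (Fin (k - 1) → Bool) → ℕ → Bool := fun c t =>
    if h : t - 1 < k - 1 then c ⟨t - 1, h⟩ else false
  -- The cut is at the earliest variable that depends on b.
  refine ⟨fun c T => hardInput n k w σ (ext c) fun t => decide (t = T),
    key (σ ⟨k, by omega⟩), fun c T T' j hj => ?_, fun c c' T j hj => ?_, fun c c' hne => ?_⟩
  · by_contra hne
    obtain ⟨p, hp, -, h2⟩ := exists_of_hardInput_ne hne
    rw [hkeyθ j p hp] at hj
    have h3 := hσ.monotone (show (⟨k, by omega⟩ : Fin (2 * k)) ≤ σ.symm p from h2 rfl)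
    simp only [Function.comp_apply, Equiv.apply_symm_apply] at h3
    exact absurd hj (not_lt.2 h3)
  · by_contra hne
    obtain ⟨p, hp, h1, -⟩ := exists_of_hardInput_ne hne
    rw [hkeyθ j p hp] at hj
    have h3 := hσ (show σ.symm p < (⟨k, by omega⟩ : Fin (2 * k)) from h1 rfl)
    simp only [Function.comp_apply, Equiv.apply_symm_apply] at h3
    exact absurd hj (not_le.2 h3)
  · obtain ⟨T, hT⟩ := Function.ne_iff.1 hne
    have hTk : (T : ℕ) + 1 < k := by have := T.2; omega
    have hval : ∀ c, safFun k w n (hardInput n k w σ (ext c) fun t => decide (t = T)) = c T := by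
      intro c
      have he : ext c (T + 1) = c T := by simp [ext]
      simp only [safFun, step₂_hardInput hw ha hTk, he, hn, true_and]
      cases c T <;> simp
    refine ⟨T, ?_⟩
    rw [hval, hval]
    exact hT

end SAF

/-- Programs for the shuffled address function are long or wide. -/
theorem two_pow_le_of_computes_safFun {K k n w v : ℕ} (hw : 4 ≤ w)
    (hn : 2 * k * w * (2 * w + Nat.clog 2 k + Nat.clog 2 (2 * w)) < n) (hk : 2 ≤ k) {δ : ℝ}
    (hδ : 0 < δ) (P : POBDD K n v) (hP : P.Computes δ (safFun k w n)) :
    2 ^ (k - 1) ≤ (⌈(K * v : ℝ) / (2 * δ)⌉₊ + 2) ^ (K * v ^ 2) := by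
  obtain ⟨X, l, hA, hB, hsep⟩ := SAF.exists_separated_inputs hw hn hk P.order
  have : Nonempty (Fin (k - 1)) := ⟨⟨0, by omega⟩⟩
  simpa using P.card_le_of_separated hδ hP X l hA hB hsep

/-! ### Estimates -/

lemma one_le_logb_two {k : ℕ} (hk : 2 ≤ k) : 1 ≤ Real.logb 2 k := by
  rw [Real.le_logb_iff_rpow_le (by norm_num) (by positivity), Real.rpow_one]
  exact_mod_cast hk

lemma logb_le_logb_mul_add {k v : ℕ} (hk : 2 ≤ k) (hv : 2 ≤ v) :
    Real.logb 2 k ≤ Real.logb 2 ((k : ℝ) * (Real.logb 2 k + Real.logb 2 v)) := by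
  have h1 := one_le_logb_two hk
  have h2 := one_le_logb_two hv
  have h3 : (2 : ℝ) ≤ k := by exact_mod_cast hk
  exact Real.logb_le_logb_of_le (by norm_num) (by positivity) (by nlinarith)

/-- With k' = k/2, w' = (w-1)/3 and L the logarithm in `h`: 2k'w' ≤ kw/3, while the bracket is at
most 6w' + L ≤ 3wL. The product is at most kw²L ≤ n/2. -/
lemma block_count_lt {k w n : ℕ} (hk : 4 < k) (hw : 20 < w) (hn : 0 < n)
    (h : (k : ℝ) * (w : ℝ) ^ 2 * Real.logb 2 ((k : ℝ) * (Real.logb 2 w + Real.logb 2 k)) ≤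
      1 / 2 * n) :
    2 * (k / 2) * ((w - 1) / 3) * (2 * ((w - 1) / 3) + Nat.clog 2 (k / 2) +
      Nat.clog 2 (2 * ((w - 1) / 3))) < n := by
  have hL := logb_le_logb_mul_add (k := k) (v := w) (by omega) (by omega)
  rw [add_comm (Real.logb 2 (w : ℝ))] at h
  set L := Real.logb 2 ((k : ℝ) * (Real.logb 2 k + Real.logb 2 w))
  have hk1 := one_le_logb_two (k := k) (by omega)
  have hc : (Nat.clog 2 (k / 2) : ℝ) ≤ L := by
    refine le_trans ?_ hL
    rw [Real.le_logb_iff_rpow_le (by norm_num) (by positivity), Real.rpow_natCast]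
    have := two_pow_clog_lt (k := k / 2) (by omega)
    exact_mod_cast (show 2 ^ Nat.clog 2 (k / 2) ≤ k by omega)
  have hc' : Nat.clog 2 (2 * ((w - 1) / 3)) ≤ 4 * ((w - 1) / 3) := by
    have h1 := two_pow_clog_lt (k := 2 * ((w - 1) / 3)) (by omega)
    have h2 := Nat.lt_two_pow_self (n := Nat.clog 2 (2 * ((w - 1) / 3)))
    omega
  have ha : ((2 * (k / 2) : ℕ) : ℝ) ≤ k := by exact_mod_cast (by omega : 2 * (k / 2) ≤ k)
  have hb : ((3 * ((w - 1) / 3) : ℕ) : ℝ) ≤ w := by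
    exact_mod_cast (by omega : 3 * ((w - 1) / 3) ≤ w)
  have hc'' : (Nat.clog 2 (2 * ((w - 1) / 3)) : ℝ) ≤ 4 * ((w - 1) / 3 : ℕ) := by
    exact_mod_cast hc'
  have hw1 : (1 : ℝ) ≤ w := by exact_mod_cast (by omega : 1 ≤ w)
  rw [← Nat.cast_lt (α := ℝ)]
  push_cast at ha hb ⊢
  have hw0 : (0 : ℝ) ≤ ((w - 1) / 3 : ℕ) := Nat.cast_nonneg _
  have hc0 : (0 : ℝ) ≤ Nat.clog 2 (k / 2) := Nat.cast_nonneg _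
  have hn' : (0 : ℝ) < n := by exact_mod_cast hn
  generalize (((w - 1) / 3 : ℕ) : ℝ) = w' at *
  generalize (Nat.clog 2 (k / 2) : ℝ) = c at *
  have hsum : 2 * w' + c + Nat.clog 2 (2 * ((w - 1) / 3)) ≤ 3 * (w * L) := by nlinarith
  have hprod : 2 * ((k / 2 : ℕ) : ℝ) * w' ≤ k * (w / 3) :=
    mul_le_mul ha (by linarith) hw0 (Nat.cast_nonneg k)
  calc _ ≤ (k * (w / 3)) * (3 * (w * L)) :=
        mul_le_mul hprod hsum (by positivity) (by positivity)
    _ = k * w ^ 2 * L := by ring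
    _ < n := by linarith

/-- Compare logarithms. For K ≥ 1 one has v ≤ V ≤ r ≤ k and K ≤ k, so the base is at most k²(1/(2δ)
+ 3) and its logarithm at most (2 + D)L. By `h` the left side has logarithm at most K r / 16 ≤ k/16,
while the right side has at least k/8. The maximum with 21 makes the growth condition on r
applicable to v. -/
lemma two_pow_gt {K k v : ℕ} {r δ : ℝ} (hδ : 0 < δ) (hk : 4 < k) (hr : 0 < r)
    (hK : (K : ℝ) ≤ k / r)
    (h : ((max v 21 : ℕ) : ℝ) ^ 2 *
        Real.logb 2 ((k : ℝ) * (Real.logb 2 k + Real.logb 2 (max v 21 : ℕ))) ≤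
      1 / (16 * (2 + Real.logb 2 (1 / (2 * δ) + 3))) * r) :
    (⌈(K * v : ℝ) / (2 * δ)⌉₊ + 2) ^ (K * v ^ 2) < 2 ^ (k / 2 - 1) := by
  -- Without layers the left side is 1; this case is apart because r ≤ k needs K ≥ 1.
  rcases Nat.eq_zero_or_pos K with rfl | hK0
  · simpa using Nat.one_lt_two_pow (by omega : k / 2 - 1 ≠ 0)
  have hL := logb_le_logb_mul_add (k := k) (v := max v 21) (by omega) (by omega)
  have hvV : (v : ℝ) ≤ (max v 21 : ℕ) := by exact_mod_cast le_max_left _ _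
  have hV1 : (1 : ℝ) ≤ (max v 21 : ℕ) := by exact_mod_cast (by omega : 1 ≤ max v 21)
  generalize ((max v 21 : ℕ) : ℝ) = V at *
  set L := Real.logb 2 ((k : ℝ) * (Real.logb 2 k + Real.logb 2 V))
  have hk1 := one_le_logb_two (k := k) (by omega)
  set D := Real.logb 2 (1 / (2 * δ) + 3) with hD
  have hE : 0 < 1 / (2 * δ) := by positivity
  have hD0 : 0 ≤ D := Real.logb_nonneg (by norm_num) (by linarith)
  have hL1 : 1 ≤ L := hk1.trans hL
  have hkR : (5 : ℝ) ≤ k := by exact_mod_cast hk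
  have hK1 : (1 : ℝ) ≤ K := by exact_mod_cast hK0
  have hKr : K * r ≤ k := (le_div_iff₀ hr).1 hK
  have hrk : r ≤ k := by nlinarith
  have hVL : 16 * (2 + D) * (V ^ 2 * L) ≤ r := by
    rw [div_mul_eq_mul_div, one_mul, le_div_iff₀ (by positivity)] at h
    linarith
  have hVr : V ≤ r := by
    have h1 : V ≤ V ^ 2 := by nlinarith
    have h2 : V ^ 2 ≤ V ^ 2 * L := le_mul_of_one_le_right (by positivity) hL1
    have h3 : V ^ 2 * L ≤ 16 * (2 + D) * (V ^ 2 * L) :=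
      le_mul_of_one_le_left (by positivity) (by linarith)
    linarith
  have hKk : (K : ℝ) ≤ k := le_trans (le_mul_of_one_le_right (by positivity) (by linarith)) hKr
  have hv0 : (0 : ℝ) ≤ v := Nat.cast_nonneg v
  have hq : ((⌈(K * v : ℝ) / (2 * δ)⌉₊ + 2 : ℕ) : ℝ) ≤ (k : ℝ) ^ 2 * (1 / (2 * δ) + 3) := by
    have h1 := Nat.ceil_lt_add_one (show 0 ≤ (K * v : ℝ) / (2 * δ) by positivity)
    have h2 : (K * v : ℝ) ≤ (k : ℝ) ^ 2 := by
      rw [pow_two]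
      exact mul_le_mul hKk (by linarith) hv0 (by positivity)
    have h3 : (K * v : ℝ) / (2 * δ) ≤ (k : ℝ) ^ 2 * (1 / (2 * δ)) := by
      rw [div_eq_mul_one_div]
      exact mul_le_mul_of_nonneg_right h2 hE.le
    push_cast
    nlinarith
  have hlog : Real.logb 2 ((⌈(K * v : ℝ) / (2 * δ)⌉₊ + 2 : ℕ) : ℝ) ≤ (2 + D) * L := by
    refine (Real.logb_le_logb_of_le (by norm_num) (by positivity) hq).trans ?_
    rw [Real.logb_mul (by positivity) (by positivity), Real.logb_pow, ← hD]
    push_cast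
    nlinarith
  by_contra hcon
  rw [not_lt, ← Nat.cast_le (α := ℝ), Nat.cast_pow, Nat.cast_pow] at hcon
  have hcon := Real.logb_le_logb_of_le (b := 2) (by norm_num) (by positivity) hcon
  rw [Real.logb_pow, Real.logb_pow, Nat.cast_ofNat, Real.logb_self_eq_one (by norm_num),
    mul_one] at hcon
  have hk' : (k : ℝ) / 8 ≤ ((k / 2 - 1 : ℕ) : ℝ) := by
    rw [div_le_iff₀ (by norm_num)]
    exact_mod_cast (by omega : k ≤ (k / 2 - 1) * 8)
  have hup : ((K * v ^ 2 : ℕ) : ℝ) * Real.logb 2 ((⌈(K * v : ℝ) / (2 * δ)⌉₊ + 2 : ℕ) : ℝ) ≤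
      k / 16 := by
    have h1 : ((K * v ^ 2 : ℕ) : ℝ) ≤ K * V ^ 2 := by
      push_cast
      gcongr
    calc ((K * v ^ 2 : ℕ) : ℝ) * Real.logb 2 ((⌈(K * v : ℝ) / (2 * δ)⌉₊ + 2 : ℕ) : ℝ)
        ≤ (K * V ^ 2) * ((2 + D) * L) := mul_le_mul h1 hlog
          (Real.logb_nonneg (by norm_num) (Nat.one_le_cast.2 (by omega))) (by positivity)
      _ = K * (16 * (2 + D) * (V ^ 2 * L)) / 16 := by ring
      _ ≤ K * r / 16 := by gcongr
      _ ≤ k / 16 := by gcongr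
  linarith

/-! ### Closure of the classes of widths -/

lemma one_isBigO_logb_pow (z : ℕ) :
    (fun _ : ℕ => (1 : ℝ)) =O[atTop] fun n : ℕ => Real.logb 2 (n : ℝ) ^ z := by
  refine IsBigO.of_bound 1 ?_
  filter_upwards [eventually_ge_atTop 2] with n hn
  have h := one_le_pow₀ (one_le_logb_two hn) (n := z)
  rw [one_mul, norm_one, Real.norm_eq_abs]
  exact h.trans (le_abs_self _)

lemma one_isBigO_rpow {α : ℝ} (hα : 0 < α) :
    (fun _ : ℕ => (1 : ℝ)) =O[atTop] fun n : ℕ => (n : ℝ) ^ α := by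
  refine IsBigO.of_bound 1 ?_
  filter_upwards [eventually_ge_atTop 1] with n hn
  have h := Real.one_le_rpow (x := n) (by exact_mod_cast hn) hα.le
  rw [one_mul, norm_one, Real.norm_eq_abs]
  exact h.trans (le_abs_self _)

lemma isBigO_mul_width {w : ℕ → ℕ} {g : ℕ → ℝ} (hw : (fun n => (w n : ℝ)) =O[atTop] g) (M : ℕ) :
    (fun n => ((M * w n : ℕ) : ℝ)) =O[atTop] g := by
  simpa using hw.const_mul_left (M : ℝ)

lemma isBigO_max_width {w : ℕ → ℕ} {g : ℕ → ℝ} (hw : (fun n => (w n : ℝ)) =O[atTop] g)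
    (hg : (fun _ : ℕ => (1 : ℝ)) =O[atTop] g) (M : ℕ) :
    (fun n => ((max (w n) M : ℕ) : ℝ)) =O[atTop] g := by
  refine IsBigO.trans (IsBigO.of_bound 1 (Eventually.of_forall fun n => ?_))
    (hw.add (hg.const_mul_left (M : ℝ)))
  rw [one_mul, mul_one, Real.norm_of_nonneg (by positivity), Real.norm_of_nonneg (by positivity)]
  exact_mod_cast max_le (Nat.le_add_right _ _) (Nat.le_add_left _ _)

/-- Absorbs the factor 8 in the number of states of the machine. -/
lemma mul_mem_widthClass {C : Set (ℕ → ℕ)} (hC : C = constWidth ∨ C = superpolylogWidth ∨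
      ∃ α : ℝ, 0 < α ∧ α < 1 / 2 ∧ C = sublinearWidth α) {w : ℕ → ℕ} (hw : w ∈ C)
    {M : ℕ} (hM : 0 < M) : (fun n => M * w n) ∈ C := by
  rcases hC with rfl | rfl | ⟨α, -, -, rfl⟩
  · obtain ⟨c, hc, h⟩ := hw
    exact ⟨M * c, by nlinarith, fun n => by simp only [h]⟩
  · obtain ⟨z, hz⟩ := hw
    exact ⟨z, isBigO_mul_width hz M⟩
  · exact isBigO_mul_width hw M

/-- Serves to lift a width above 20, and to leave room for brute force on finitely many n. -/
lemma max_mem_widthClass {C : Set (ℕ → ℕ)} (hC : C = constWidth ∨ C = superpolylogWidth ∨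
      ∃ α : ℝ, 0 < α ∧ α < 1 / 2 ∧ C = sublinearWidth α) {w : ℕ → ℕ} (hw : w ∈ C)
    (M : ℕ) : (fun n => max (w n) M) ∈ C := by
  rcases hC with rfl | rfl | ⟨α, hα, -, rfl⟩
  · obtain ⟨c, hc, h⟩ := hw
    exact ⟨max c M, by omega, fun n => by simp only [h]⟩
  · obtain ⟨z, hz⟩ := hw
    exact ⟨z, isBigO_max_width hz (one_isBigO_logb_pow z) M⟩
  · exact isBigO_max_width hw (one_isBigO_rpow hα) M

/-- A class does not shrink if the number of layers is increased, even if only for large `n`. -/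
theorem POBDDClass_subset_of_eventually_le {C : Set (ℕ → ℕ)}
    (hC : ∀ v ∈ C, ∀ M : ℕ, (fun n => max (v n) M) ∈ C) {K k : ℕ → ℕ} (hk : ∀ n, 0 < k n)
    (h : ∀ᶠ n in atTop, K n ≤ k n) : POBDDClass K C ⊆ POBDDClass k C := by
  rintro f ⟨v, hv, δ, hδ, hP⟩
  obtain ⟨N, hN⟩ := eventually_atTop.1 h
  -- Width 2 ^ N stores the whole input for every n < N; the margin is lowered because exact
  -- computation only gives margins below 1/2.
  refine ⟨_, hC v hv (2 ^ N), min δ (1 / 4), by positivity, fun n => ?_⟩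
  rcases Nat.lt_or_ge n N with hn | hn
  · exact exists_POBDD_of_two_pow_le (hk n)
      ((Nat.pow_le_pow_right (by norm_num) hn.le).trans (le_max_right _ _)) _
      ((min_le_right _ _).trans_lt (by norm_num))
  · obtain ⟨P, hP⟩ := hP n
    obtain ⟨Q, hQ⟩ := P.exists_computes_of_layers_le (hN n hn)
      (POBDD.computes_mono (min_le_left δ (1 / 4)) hP)
    exact Q.exists_computes_of_width_le (le_max_left _ _) hQ

/-! ### The separation of the classes. -/

theorem theorem10 (C : Set (ℕ → ℕ))
    (hC : C = constWidth ∨ C = superpolylogWidth ∨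
      ∃ α : ℝ, 0 < α ∧ α < 1 / 2 ∧ C = sublinearWidth α)
    (k w : ℕ → ℕ) (r : ℕ → ℝ)
    (hk : ∀ n, 4 < k n) (hw : ∀ n, 20 < w n) (hr : ∀ n, 0 < r n) (hwC : w ∈ C)
    (hn : (fun n => (k n : ℝ) * (w n : ℝ) ^ 2 *
        Real.logb 2 ((k n : ℝ) * (Real.logb 2 (w n) + Real.logb 2 (k n))))
      =o[atTop] fun n : ℕ => (n : ℝ))
    (hrv : ∀ v ∈ C, (∀ n, 20 < v n) →
      (fun n => (v n : ℝ) ^ 2 *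
        Real.logb 2 ((k n : ℝ) * (Real.logb 2 (k n) + Real.logb 2 (v n)))) =o[atTop] r) :
    POBDDClass (fun n => ⌊(k n : ℝ) / r n⌋₊) C ⊂ POBDDClass k C ∧
      (fun n => safFun (k n / 2) ((w n - 1) / 3) n) ∈ POBDDClass k C ∧
      (fun n => safFun (k n / 2) ((w n - 1) / 3) n) ∉
        POBDDClass (fun n => ⌊(k n : ℝ) / r n⌋₊) C := by
  have hmem : (fun n => safFun (k n / 2) ((w n - 1) / 3) n) ∈ POBDDClass k C := by
    -- Width 8w suffices because 2⌊(w-1)/3⌋ + 1 ≤ w.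
    refine ⟨_, mul_mem_widthClass hC hwC (M := 8) (by norm_num), 1 / 4, by norm_num, fun n => ?_⟩
    have := hk n
    have := hw n
    exact exists_POBDD_safFun (by omega) (by omega) (by omega) (by omega) (by norm_num)
  have hnot : (fun n => safFun (k n / 2) ((w n - 1) / 3) n) ∉
      POBDDClass (fun n => ⌊(k n : ℝ) / r n⌋₊) C := by
    rintro ⟨v, hv, δ, hδ, hP⟩
    have hD : 0 ≤ Real.logb 2 (1 / (2 * δ) + 3) :=
      Real.logb_nonneg (by norm_num) (by have : 0 < 1 / (2 * δ) := by positivity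
                                         linarith)
    have h1 := (hrv _ (max_mem_widthClass hC hv 21) fun n => by omega).bound
      (show 0 < 1 / (16 * (2 + Real.logb 2 (1 / (2 * δ) + 3))) by positivity)
    have h2 := hn.bound (show (0 : ℝ) < 1 / 2 by norm_num)
    -- A single n that satisfies both estimates gives the contradiction.
    obtain ⟨n, h1, h2, hn0⟩ := (h1.and (h2.and (eventually_gt_atTop 0))).exists
    have h1 := (le_abs_self _).trans h1
    rw [Real.norm_of_nonneg (hr n).le] at h1
    have h2 := (le_abs_self _).trans h2
    rw [Real.norm_of_nonneg (Nat.cast_nonneg n)] at h2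
    obtain ⟨P, hP⟩ := hP n
    have hk' := hk n
    have hw' := hw n
    have hle := two_pow_le_of_computes_safFun (by omega) (block_count_lt hk' hw' hn0 h2) (by omega)
      hδ P hP
    exact absurd hle (not_le.2 (two_pow_gt hδ hk' (hr n)
      (Nat.floor_le (div_nonneg (Nat.cast_nonneg _) (hr n).le)) h1))
  refine ⟨⟨POBDDClass_subset_of_eventually_le (fun v hv => max_mem_widthClass hC hv)
    (fun n => by have := hk n; omega) ?_, fun h => hnot (h hmem)⟩, hmem, hnot⟩
  -- The left side of the growth condition for w is at least 1, hence r ≥ 1 eventually and ⌊k/r⌋ ≤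
  -- k.
  filter_upwards [(hrv w hwC hw).bound one_pos] with n h
  have h := (le_abs_self _).trans h
  rw [Real.norm_of_nonneg (hr n).le, one_mul] at h
  have hk' := hk n
  have hw' := hw n
  have h1 := (one_le_logb_two (k := k n) (by omega)).trans
    (logb_le_logb_mul_add (k := k n) (v := w n) (by omega) (by omega))
  have h2 : (1 : ℝ) ≤ (w n : ℝ) ^ 2 := one_le_pow₀ (by exact_mod_cast (by omega : 1 ≤ w n))
  have h3 : 1 ≤ r n := (one_le_mul_of_one_le_of_one_le h2 h1).trans h
  exact Nat.floor_le_of_le (div_le_self (Nat.cast_nonneg _) h3)
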